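/- Let $n \ge 38$ be an integer, let $K \ge n-5$ be a real number and put $\eta = \frac{K-n+5}{K+n-5} \in [0,1)$. Let $F_{2,2,n}$ be the Fock space of $4n$ modes in the Segal--Bargmann representation: the Hilbert space of holomorphic functions $\psi(z,z')$, $z=(z_{k,i})$, $z'=(z'_{k,j})$ with $1\le k\le n$ and $i,j\in\{1,2\}$, such that $\|\psi\|^2=\pi^{-4n}\int_{\mathbb C^{2n}\times\mathbb C^{2n}} e^{-|z|^2-|z'|^2}|\psi(z,z')|^2\,dz\,dz'<\infty$. Let $\mathcal D$ be the set of complex $2\times2$ matrices $\Lambda$ such that $1-\Lambda\Lambda^\dagger$ is positive definite, and for $\Lambda\in\mathcal D$ let $|\Lambda,n\rangle\in F_{2,2,n}$ be the coherent state $$\psi_{\Lambda,n}(z,z')=\det(1-\Lambda\Lambda^\dagger)^{n/2}\exp\Big(\sum_{i,j=1}^2\Lambda_{ij}Z_{ij}\Big),\qquad Z_{ij}=\sum_{k=1}^n z_{k,i}z'_{k,j}.$$ Let $\mu_n$ be the measure $$d\mu_n(\Lambda)=\frac{(n-1)(n-2)^2(n-3)}{\pi^4\det(1-\Lambda\Lambda^\dagger)^4}\prod_{i,j=1}^2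 d\,\mathrm{Re}(\Lambda_{ij})\,d\,\mathrm{Im}(\Lambda_{ij})$$ on $\mathcal D$, and let $\mathcal D_\eta$ be the set of complex $2\times2$ matrices $\Lambda$ such that $\eta 1-\Lambda\Lambda^\dagger$ is positive semidefinite. Then the operator-valued function $\Lambda\mapsto|\Lambda,n\rangle\langle\Lambda,n|$ is integrable over $\mathcal D_\eta$ with respect to $\mu_n$, its integral is a trace-class operator on $F_{2,2,n}$, and its trace $$T(n,\eta):=\mathrm{tr}\int_{\mathcal D_\eta}|\Lambda,n\rangle\langle\Lambda,n|\,d\mu_n(\Lambda)$$ satisfies $$T(n,\eta)=\frac{(n-1)(n-2)^2(n-3)\,\eta^4}{12(1-\eta)^4},\qquad T(n,\eta)\le\frac{K^4}{100},\qquad T(n,\eta)+1\le\frac{K^4}{100}.$$ -/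

import Mathlib

open MeasureTheory Complex Filter Topology
open scoped ComplexConjugate ComplexOrder ENNReal

noncomputable section

namespace SU22

/-- The phase space `ℂ^{2n} × ℂ^{2n}`: a point is a pair `(z, z')`, with `z k i` and `z' k j` the
coordinates `z_{k,i}` and `z'_{k,j}` for `k ≤ n` and `i, j ∈ {1, 2}`. -/
abbrev Modes (n : ℕ) : Type := (Fin n → Fin 2 → ℂ) × (Fin n → Fin 2 → ℂ)

/-- `|z|² + |z'|²`. -/
def sqNorm {n : ℕ} (p : Modes n) : ℝ := (∑ k, ∑ i, ‖p.1 k i‖ ^ 2) + ∑ k, ∑ j, ‖p.2 k j‖ ^ 2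

/-- The Gaussian measure `π^{-4n} exp (-|z|² - |z'|²) dz dz'`. -/
def gaussian (n : ℕ) : Measure (Modes n) :=
  volume.withDensity fun p => ENNReal.ofReal ((Real.pi ^ (4 * n))⁻¹ * Real.exp (-sqNorm p))

/-- The subspace of `L²` of the Gaussian measure formed by the (classes of) holomorphic functions
on `ℂ^{4n}`. -/
def fockSubmodule (n : ℕ) : Submodule ℂ (Lp ℂ 2 (gaussian n)) where
  carrier := {f | ∃ g : Modes n → ℂ, Differentiable ℂ g ∧ f =ᵐ[gaussian n] g}
  zero_mem' := ⟨0, differentiable_const 0, Lp.coeFn_zero _ _ _⟩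
  add_mem' := by
    rintro f₁ f₂ ⟨g₁, h₁, e₁⟩ ⟨g₂, h₂, e₂⟩
    exact ⟨g₁ + g₂, h₁.add h₂, (Lp.coeFn_add _ _).trans (e₁.add e₂)⟩
  smul_mem' := by
    rintro c f ⟨g, h, e⟩
    exact ⟨c • g, h.const_smul c, (Lp.coeFn_smul _ _).trans (e.const_smul c)⟩

/-! ### The Fock space is complete -/

instance isAddHaarMeasure_modes (n : ℕ) : (volume : Measure (Modes n)).IsAddHaarMeasure := by
  have : (volume : Measure (Fin n → Fin 2 → ℂ)).IsAddHaarMeasure :=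
    Measure.pi.isAddHaarMeasure (fun _ => volume)
  exact Measure.prod.instIsAddHaarMeasure _ _

instance sigmaFinite_modes (n : ℕ) : SigmaFinite (volume : Measure (Modes n)) := by
  exact Measure.prod.instSigmaFinite

lemma integrable_exp_neg_sqNorm (n : ℕ) {a : ℝ} (ha : 0 < a) :
    Integrable (fun p : Modes n => Real.exp (-a * sqNorm p)) := by
  have h0 : Integrable (fun z : ℂ => Real.exp (-a * ‖z‖ ^ 2)) := by
    have h := (GaussianFourier.integrable_cexp_neg_mul_sq_norm_add (b := (a : ℂ)) (V := ℂ)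
      (by simpa using ha) 0 0).norm
    refine h.congr (Eventually.of_forall fun z => ?_)
    simp only [zero_mul, add_zero]
    rw [Complex.norm_exp]
    congr 1
    norm_cast
  have h2 : Integrable (fun z : Fin n → Fin 2 → ℂ => ∏ k, ∏ i, Real.exp (-a * ‖z k i‖ ^ 2)) :=
    Integrable.fintype_prod (f := fun (_ : Fin n) (z : Fin 2 → ℂ) =>
      ∏ i, Real.exp (-a * ‖z i‖ ^ 2)) (fun _ => Integrable.fintype_prod (fun _ => h0))
  refine (h2.mul_prod h2).congr (Eventually.of_forall fun p => ?_)
  simp only [← Real.exp_sum, ← Real.exp_add, sqNorm, mul_add, Finset.mul_sum]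

instance isFiniteMeasure_gaussian (n : ℕ) : IsFiniteMeasure (gaussian n) := by
  refine isFiniteMeasure_withDensity_ofReal ?_
  have h := (integrable_exp_neg_sqNorm n one_pos).const_mul (Real.pi ^ (4 * n))⁻¹
  simp only [neg_mul, one_mul] at h
  exact h.hasFiniteIntegral

lemma continuous_sqNorm (n : ℕ) : Continuous (sqNorm (n := n)) := by
  unfold sqNorm; fun_prop

lemma measurePreserving_rot (n : ℕ) (c : ℂ) (hc : ‖c‖ = 1) :
    MeasurePreserving (fun p : Modes n => c • p) := by
  have h1 : MeasurePreserving (fun z : ℂ => c • z) := by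
    have := (rotation ⟨c, by simpa [Submonoid.unitSphere] using hc⟩).measurePreserving
    exact this
  have h2 : MeasurePreserving (fun z : Fin n → Fin 2 → ℂ => c • z) :=
    volume_preserving_pi (fun _ => volume_preserving_pi (fun _ => h1))
  exact h2.prod h2

/-- Mean value inequality on a ball. -/
lemma mean_value_ball {n : ℕ} {h : Modes n → ℂ} (hh : Differentiable ℂ h) :
    ‖h 0‖ₑ * volume (Metric.ball (0 : Modes n) 1) ≤
      ∫⁻ w in Metric.ball (0 : Modes n) 1, ‖h w‖ₑ := by
  set B := Metric.ball (0 : Modes n) 1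
  set I := Set.Ioc (0 : ℝ) (2 * Real.pi)
  set e : ℝ → ℂ := fun θ => circleMap 0 1 θ
  have hcont : Continuous h := hh.continuous
  have he : ∀ θ, ‖e θ‖ = 1 := fun θ => by simp [e]
  have hce : Continuous e := continuous_circleMap 0 1
  have hpi : (0 : ℝ) < 2 * Real.pi := by positivity
  have key : ∀ w : Modes n, ‖h 0‖ₑ * ENNReal.ofReal (2 * Real.pi) ≤ ∫⁻ θ in I, ‖h (e θ • w)‖ₑ := by
    intro w
    have hd : Differentiable ℂ (fun t : ℂ => h (t • w)) :=
      hh.comp (differentiable_id.smul_const w)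
    have h1 := (hd.diffContOnCl (s := Metric.ball 0 |(1 : ℝ)|)).circleAverage
    rw [Real.circleAverage_def] at h1
    simp only [zero_smul] at h1
    rw [intervalIntegral.integral_of_le hpi.le] at h1
    have h2 : ‖∫ θ in I, h (e θ • w)‖ₑ ≤ ∫⁻ θ in I, ‖h (e θ • w)‖ₑ :=
      enorm_integral_le_lintegral_enorm _
    refine le_trans (le_of_eq ?_) h2
    rw [← h1, enorm_smul]
    have : ‖(2 * Real.pi)⁻¹‖ₑ = (ENNReal.ofReal (2 * Real.pi))⁻¹ := by
      rw [Real.enorm_eq_ofReal (by positivity), ENNReal.ofReal_inv_of_pos hpi]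
    rw [this, mul_comm, ← mul_assoc, ENNReal.mul_inv_cancel, one_mul]
    · simpa using Real.pi_pos
    · exact ENNReal.ofReal_ne_top
  have hinv : ∀ θ, ∫⁻ w in B, ‖h (e θ • w)‖ₑ = ∫⁻ w in B, ‖h w‖ₑ := by
    intro θ
    have hm := (measurePreserving_rot n (e θ) (he θ)).restrict_preimage
      (s := B) Metric.isOpen_ball.measurableSet
    have hB : (fun p : Modes n => e θ • p) ⁻¹' B = B := by
      ext p; simp [B, norm_smul, he]
    rw [hB] at hm
    exact hm.lintegral_comp (f := fun w => ‖h w‖ₑ) hcont.measurable.enorm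
  have hm : ∫⁻ _ in B, (‖h 0‖ₑ * ENNReal.ofReal (2 * Real.pi)) ≤
      ∫⁻ w in B, ∫⁻ θ in I, ‖h (e θ • w)‖ₑ := lintegral_mono key
  rw [lintegral_lintegral_swap] at hm
  · simp only [hinv, lintegral_const, Measure.restrict_apply_univ] at hm
    have hI : volume I = ENNReal.ofReal (2 * Real.pi) := by simp [I]
    rw [hI, mul_right_comm] at hm
    exact (ENNReal.mul_le_mul_iff_left (by simpa using Real.pi_pos) ENNReal.ofReal_ne_top).1 hm
  · refine Measurable.aemeasurable ?_
    refine Measurable.enorm (Continuous.measurable ?_)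
    exact hcont.comp ((hce.comp continuous_snd).smul continuous_fst)

lemma density_pos {n : ℕ} (p : Modes n) :
    0 < (Real.pi ^ (4 * n))⁻¹ * Real.exp (-sqNorm p) := by positivity

/-- On bounded sets, holomorphic functions are controlled by their `L²` norm. -/
lemma exists_bound (n : ℕ) (R : ℝ) : ∃ C : ℝ≥0∞, C ≠ ∞ ∧ ∀ g : Modes n → ℂ, Differentiable ℂ g →
    ∀ z, ‖z‖ ≤ R → ‖g z‖ₑ ≤ C * eLpNorm g 2 (gaussian n) := by
  set ρ : Modes n → ℝ := fun p => (Real.pi ^ (4 * n))⁻¹ * Real.exp (-sqNorm p)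
  have hρ : Continuous ρ := by
    have := continuous_sqNorm n
    fun_prop
  have hBm : ∀ z : Modes n, MeasurableSet (Metric.ball z 1) :=
    fun z => Metric.isOpen_ball.measurableSet
  set S := Metric.closedBall (0 : Modes n) (R + 1)
  have hS : IsCompact S := isCompact_closedBall _ _
  have hfin : gaussian n S ≠ ∞ := measure_ne_top _ _
  obtain ⟨c, hc0, hc⟩ : ∃ c : ℝ, 0 < c ∧ ∀ p ∈ S, c ≤ ρ p := by
    rcases S.eq_empty_or_nonempty with h | h
    · exact ⟨1, one_pos, by simp [h]⟩
    · obtain ⟨p, hp, hmin⟩ := hS.exists_isMinOn h hρ.continuousOn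
      exact ⟨ρ p, density_pos p, fun q hq => hmin hq⟩
  set V := volume (Metric.ball (0 : Modes n) 1)
  have hV0 : V ≠ 0 := (Metric.measure_ball_pos _ _ one_pos).ne'
  have hVt : V ≠ ∞ := measure_ball_lt_top.ne
  have hc0' : ENNReal.ofReal c ≠ 0 := by simpa using hc0
  refine ⟨V⁻¹ * ((ENNReal.ofReal c)⁻¹ * gaussian n S ^ (1 / (1 : ℝ≥0∞).toReal - 1 / (2 : ℝ≥0∞).toReal)), ?_, ?_⟩
  · refine ENNReal.mul_ne_top (by simpa using hV0) (ENNReal.mul_ne_top (by simpa using hc0) ?_)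
    exact ENNReal.rpow_ne_top_of_nonneg (by norm_num) hfin
  intro g hg z hz
  have h1 := mean_value_ball (h := fun w => g (z + w))
    (hg.comp ((differentiable_const z).add differentiable_id))
  simp only [add_zero] at h1
  have h2 : ∫⁻ w in Metric.ball (0 : Modes n) 1, ‖g (z + w)‖ₑ = ∫⁻ w in Metric.ball z 1, ‖g w‖ₑ := by
    have : MeasurableAdd (Modes n) := ContinuousAdd.measurableAdd
    have hm := (measurePreserving_add_left (volume : Measure (Modes n)) z).restrict_preimage
      (hBm z)
    have hB : (fun w => z + w) ⁻¹' Metric.ball z 1 = Metric.ball (0 : Modes n) 1 := by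
      ext w; simp [dist_eq_norm]
    rw [hB] at hm
    exact hm.lintegral_comp (f := fun w => ‖g w‖ₑ) hg.continuous.measurable.enorm
  have hsub : Metric.ball z 1 ⊆ S := by
    intro w hw
    simp only [S, Metric.mem_closedBall, dist_zero_right]
    have : ‖w - z‖ < 1 := by simpa [dist_eq_norm] using hw
    calc ‖w‖ = ‖z + (w - z)‖ := by simp
      _ ≤ ‖z‖ + ‖w - z‖ := norm_add_le _ _
      _ ≤ R + 1 := by linarith
  have h3 : ENNReal.ofReal c * ∫⁻ w in Metric.ball z 1, ‖g w‖ₑ ≤ ∫⁻ w in S, ‖g w‖ₑ ∂(gaussian n) := by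
    rw [gaussian, restrict_withDensity hS.measurableSet,
      lintegral_withDensity_eq_lintegral_mul _ (by exact hρ.measurable.ennreal_ofReal)
        hg.continuous.measurable.enorm,
      ← lintegral_const_mul _ hg.continuous.measurable.enorm]
    calc _ ≤ ∫⁻ w in S, ENNReal.ofReal c * ‖g w‖ₑ := lintegral_mono_set hsub
      _ ≤ _ := by
        refine setLIntegral_mono' hS.measurableSet fun w hw => ?_
        exact mul_le_mul_left (ENNReal.ofReal_le_ofReal (hc w hw)) _
  have h4 := eLpNorm_le_eLpNorm_mul_rpow_measure_univ (p := 1) (q := 2)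
    (μ := (gaussian n).restrict S) (f := g) (by norm_num)
    hg.continuous.aestronglyMeasurable
  rw [eLpNorm_one_eq_lintegral_enorm, Measure.restrict_apply_univ] at h4
  have h5 : eLpNorm g 2 ((gaussian n).restrict S) ≤ eLpNorm g 2 (gaussian n) :=
    eLpNorm_mono_measure _ Measure.restrict_le_self
  have h6 : ENNReal.ofReal c * (‖g z‖ₑ * V) ≤ eLpNorm g 2 (gaussian n) *
      gaussian n S ^ (1 / (1 : ℝ≥0∞).toReal - 1 / (2 : ℝ≥0∞).toReal) :=
    calc _ ≤ ENNReal.ofReal c * ∫⁻ w in Metric.ball z 1, ‖g w‖ₑ := by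
            rw [← h2]; exact mul_le_mul_right h1 _
      _ ≤ _ := h3.trans (h4.trans (mul_le_mul_left h5 _))
  have h7 : ‖g z‖ₑ = V⁻¹ * ((ENNReal.ofReal c)⁻¹ * (ENNReal.ofReal c * (‖g z‖ₑ * V))) := by
    rw [← mul_assoc (ENNReal.ofReal c)⁻¹, ENNReal.inv_mul_cancel hc0' ENNReal.ofReal_ne_top,
      one_mul, mul_comm ‖g z‖ₑ, ← mul_assoc, ENNReal.inv_mul_cancel hV0 hVt, one_mul]
  rw [h7]
  calc _ ≤ V⁻¹ * ((ENNReal.ofReal c)⁻¹ * (eLpNorm g 2 (gaussian n) *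
      gaussian n S ^ (1 / (1 : ℝ≥0∞).toReal - 1 / (2 : ℝ≥0∞).toReal))) := by gcongr
    _ = _ := by ring

lemma exists_bound_real (n : ℕ) (R : ℝ) : ∃ C : ℝ, 0 ≤ C ∧ ∀ (f : Lp ℂ 2 (gaussian n))
    (g : Modes n → ℂ), Differentiable ℂ g → f =ᵐ[gaussian n] g →
    ∀ z, ‖z‖ ≤ R → ‖g z‖ ≤ C * ‖f‖ := by
  obtain ⟨C, hC, h⟩ := exists_bound n R
  refine ⟨C.toReal, ENNReal.toReal_nonneg, fun f g hg hfg z hz => ?_⟩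
  have h1 := h g hg z hz
  rw [← eLpNorm_congr_ae hfg] at h1
  have h2 := ENNReal.toReal_mono (ENNReal.mul_ne_top hC (Lp.eLpNorm_ne_top f)) h1
  rwa [ENNReal.toReal_mul, toReal_enorm, ← Lp.norm_def] at h2

/-- Cauchy's estimate for the derivative. -/
lemma norm_fderiv_le {n : ℕ} {g : Modes n → ℂ} (hg : Differentiable ℂ g) {z : Modes n} {M : ℝ}
    (hM : 0 ≤ M) (h : ∀ w, ‖w‖ ≤ ‖z‖ + 1 → ‖g w‖ ≤ M) : ‖fderiv ℂ g z‖ ≤ M := by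
  refine ContinuousLinearMap.opNorm_le_of_unit_norm hM fun v hv => ?_
  have hd : Differentiable ℂ (fun t : ℂ => g (z + t • v)) :=
    hg.comp ((differentiable_const z).add (differentiable_id.smul_const v))
  have h1 : deriv (fun t : ℂ => g (z + t • v)) 0 = fderiv ℂ g z v := by
    have h2 : HasDerivAt (fun t : ℂ => z + t • v) v 0 := by
      simpa using ((hasDerivAt_id (0 : ℂ)).smul_const v).const_add z
    have h3 : HasFDerivAt g (fderiv ℂ g z) (z + (0 : ℂ) • v) := by
      simpa using (hg z).hasFDerivAt
    exact (h3.comp_hasDerivAt (0 : ℂ) h2).deriv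
  rw [← h1]
  have h4 := Complex.norm_deriv_le_of_forall_mem_sphere_norm_le (c := 0) (R := 1) (C := M)
    one_pos hd.diffContOnCl (fun t ht => h _ ?_)
  · simpa using h4
  · have ht' : ‖t‖ = 1 := by simpa using ht
    calc ‖z + t • v‖ ≤ ‖z‖ + ‖t • v‖ := norm_add_le _ _
      _ = ‖z‖ + 1 := by rw [norm_smul, ht', hv, one_mul]

lemma isClosed_fock (n : ℕ) : IsClosed (fockSubmodule n : Set (Lp ℂ 2 (gaussian n))) := by
  refine IsSeqClosed.isClosed ?_
  intro f f₀ hf hlim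
  choose g hg hfg using hf
  have hcau : CauchySeq f := hlim.cauchySeq
  have hsub : ∀ i j, (f i - f j : Lp ℂ 2 (gaussian n)) =ᵐ[gaussian n] g i - g j := fun i j =>
    (Lp.coeFn_sub _ _).trans ((hfg i).sub (hfg j))
  have hpt : ∀ z, CauchySeq fun i => g i z := by
    intro z
    obtain ⟨C, hC, hb⟩ := exists_bound_real n ‖z‖
    rw [Metric.cauchySeq_iff] at hcau ⊢
    intro ε hε
    obtain ⟨N, hN⟩ := hcau (ε / (C + 1)) (by positivity)
    refine ⟨N, fun i hi j hj => ?_⟩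
    have h1 := hb _ _ ((hg i).sub (hg j)) (hsub i j) z le_rfl
    have h2 := hN i hi j hj
    rw [dist_eq_norm] at h2 ⊢
    rw [lt_div_iff₀ (by positivity)] at h2
    simp only [Pi.sub_apply] at h1
    nlinarith [norm_nonneg (f i - f j)]
  choose g₀ hg₀ using fun z => cauchySeq_tendsto_of_complete (hpt z)
  have hder : ∀ R : ℝ, UniformCauchySeqOn (fun i z => fderiv ℂ (g i) z) atTop
      (Metric.ball (0 : Modes n) R) := by
    intro R
    obtain ⟨C, hC, hb⟩ := exists_bound_real n (R + 1)
    rw [Metric.uniformCauchySeqOn_iff]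
    rw [Metric.cauchySeq_iff] at hcau
    intro ε hε
    obtain ⟨N, hN⟩ := hcau (ε / (C + 1)) (by positivity)
    refine ⟨N, fun i hi j hj z hz => ?_⟩
    have hz' : ‖z‖ < R := by simpa using hz
    have h1 : ‖fderiv ℂ (g i - g j) z‖ ≤ C * ‖f i - f j‖ :=
      norm_fderiv_le ((hg i).sub (hg j)) (by positivity) fun w hw =>
        hb _ _ ((hg i).sub (hg j)) (hsub i j) w (by linarith)
    have h2 := hN i hi j hj
    rw [fderiv_sub (hg i z) (hg j z)] at h1
    rw [dist_eq_norm] at h2 ⊢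
    rw [lt_div_iff₀ (by positivity)] at h2
    nlinarith [norm_nonneg (f i - f j)]
  have hder_pt : ∀ z, ∃ L, Tendsto (fun i => fderiv ℂ (g i) z) atTop (𝓝 L) := fun z =>
    cauchySeq_tendsto_of_complete ((hder (‖z‖ + 1)).cauchySeq (by simp))
  choose g' hg' using hder_pt
  refine ⟨g₀, fun z => ?_, ?_⟩
  · have hu : TendstoUniformlyOn (fun i z => fderiv ℂ (g i) z) g' atTop
        (Metric.ball (0 : Modes n) (‖z‖ + 1)) :=
      (hder _).tendstoUniformlyOn_of_tendsto fun w _ => hg' w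
    exact (hasFDerivAt_of_tendstoUniformlyOn Metric.isOpen_ball hu
      (fun i w _ => (hg i w).hasFDerivAt) (fun w _ => hg₀ w) (by simp)).differentiableAt
  · obtain ⟨ns, hns, hae⟩ := (tendstoInMeasure_of_tendsto_Lp hlim).exists_seq_tendsto_ae
    have hall : ∀ᵐ x ∂(gaussian n), ∀ i, f i x = g i x := ae_all_iff.2 hfg
    filter_upwards [hae, hall] with x h1 h2
    refine tendsto_nhds_unique h1 ?_
    simp only [h2]
    exact (hg₀ x).comp hns.tendsto_atTop

/-- The Fock space `F_{2,2,n}` in the Segal-Bargmann representation: the holomorphic functions on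
`ℂ^{4n}` that are square-integrable for the Gaussian measure, with the inner product of `L²`. -/
def Fock (n : ℕ) : Type := fockSubmodule n

instance normedAddCommGroup_fock (n : ℕ) : NormedAddCommGroup (Fock n) :=
  inferInstanceAs (NormedAddCommGroup (fockSubmodule n))

instance innerProductSpace_fock (n : ℕ) : InnerProductSpace ℂ (Fock n) :=
  inferInstanceAs (InnerProductSpace ℂ (fockSubmodule n))

instance completeSpace_fock (n : ℕ) : CompleteSpace (Fock n) :=
  (isClosed_fock n).completeSpace_coe

/-! ### Coherent states -/

/-- The domain `𝒟` of the complex `2 × 2` matrices `Λ` with `Λ Λ† < 1`. -/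
def domain : Set (Fin 2 → Fin 2 → ℂ) :=
  {Λ | (1 - Matrix.of Λ * (Matrix.of Λ).conjTranspose).PosDef}

/-- The domain `𝒟_η` of the complex `2 × 2` matrices `Λ` with `Λ Λ† ≤ η 1`. -/
def cutDomain (η : ℝ) : Set (Fin 2 → Fin 2 → ℂ) :=
  {Λ | ((η : ℂ) • 1 - Matrix.of Λ * (Matrix.of Λ).conjTranspose).PosSemidef}

/-- `det (1 - Λ Λ†)`, a positive real number for `Λ` in the domain. -/
def gap (Λ : Fin 2 → Fin 2 → ℂ) : ℝ :=
  (1 - Matrix.of Λ * (Matrix.of Λ).conjTranspose).det.re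

/-- The variables `Z_{i,j} = ∑ₖ z_{k,i} z'_{k,j}`. -/
def Z {n : ℕ} (p : Modes n) (i j : Fin 2) : ℂ := ∑ k, p.1 k i * p.2 k j

/-- The function `det (1 - Λ Λ†)^{n/2} exp (∑_{i,j} Λ_{i,j} Z_{i,j})`. -/
def cohFun (n : ℕ) (Λ : Fin 2 → Fin 2 → ℂ) (p : Modes n) : ℂ :=
  ((gap Λ ^ ((n : ℝ) / 2) : ℝ) : ℂ) * Complex.exp (∑ i, ∑ j, Λ i j * Z p i j)

lemma differentiable_cohFun (n : ℕ) (Λ : Fin 2 → Fin 2 → ℂ) : Differentiable ℂ (cohFun n Λ) := by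
  unfold cohFun Z; fun_prop

lemma strict_bound {Λ : Fin 2 → Fin 2 → ℂ} (hΛ : Λ ∈ domain) (x y : Fin 2 → ℂ)
    (hxy : (∑ i, ‖x i‖ ^ 2) + ∑ j, ‖y j‖ ^ 2 = 1) :
    2 * (∑ i, ∑ j, Λ i j * (x i * y j)).re < 1 := by
  by_cases hx : x = 0
  · simp [hx]
  have hx' : (star x) ≠ 0 := by simpa using hx
  have h1 := hΛ.re_dotProduct_pos hx'
  have h2 : (star (star x) ⬝ᵥ (1 - Matrix.of Λ * (Matrix.of Λ).conjTranspose).mulVec (star x)).re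
      = (∑ i, ‖x i‖ ^ 2) - ∑ j, ‖∑ i, Λ i j * x i‖ ^ 2 := by
    simp only [← Complex.normSq_eq_norm_sq]
    simp [Matrix.mulVec, dotProduct, Fin.sum_univ_two, Matrix.mul_apply, Complex.normSq_apply]
    ring
  have h3 : 0 < (∑ i, ‖x i‖ ^ 2) - ∑ j, ‖∑ i, Λ i j * x i‖ ^ 2 := by rw [← h2]; exact h1
  have h4 : 2 * (∑ i, ∑ j, Λ i j * (x i * y j)).re ≤
      (∑ j, ‖∑ i, Λ i j * x i‖ ^ 2) + ∑ j, ‖y j‖ ^ 2 := by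
    have h5 : ∀ a b : ℂ, 2 * (a * b).re ≤ ‖a‖ ^ 2 + ‖b‖ ^ 2 := fun a b => by
      have := Complex.re_le_norm (a * b)
      rw [norm_mul] at this
      nlinarith [sq_nonneg (‖a‖ - ‖b‖)]
    have h6 : ∑ i, ∑ j, Λ i j * (x i * y j) = ∑ j, (∑ i, Λ i j * x i) * y j := by
      simp only [Fin.sum_univ_two]; ring
    rw [h6, Complex.re_sum, Finset.mul_sum, ← Finset.sum_add_distrib]
    exact Finset.sum_le_sum fun j _ => h5 _ _
  linarith

lemma uniform_bound {Λ : Fin 2 → Fin 2 → ℂ} (hΛ : Λ ∈ domain) :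
    ∃ s < 1, ∀ x y : Fin 2 → ℂ, 2 * (∑ i, ∑ j, Λ i j * (x i * y j)).re ≤
      s * ((∑ i, ‖x i‖ ^ 2) + ∑ j, ‖y j‖ ^ 2) := by
  set q : (Fin 2 → ℂ) × (Fin 2 → ℂ) → ℝ := fun p => (∑ i, ‖p.1 i‖ ^ 2) + ∑ j, ‖p.2 j‖ ^ 2
  set b : (Fin 2 → ℂ) × (Fin 2 → ℂ) → ℝ := fun p => 2 * (∑ i, ∑ j, Λ i j * (p.1 i * p.2 j)).re
  have hq : Continuous q := by fun_prop
  have hb : Continuous b := by fun_prop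
  set S := q ⁻¹' {1}
  have hS : IsCompact S := by
    refine Metric.isCompact_of_isClosed_isBounded (isClosed_singleton.preimage hq) ?_
    refine (Metric.isBounded_closedBall (x := 0) (r := 1)).subset fun p hp => ?_
    have hp' : (∑ i, ‖p.1 i‖ ^ 2) + ∑ j, ‖p.2 j‖ ^ 2 = 1 := hp
    simp only [Fin.sum_univ_two] at hp'
    simp only [Metric.mem_closedBall, dist_zero_right, Prod.norm_def, sup_le_iff,
      pi_norm_le_iff_of_nonneg zero_le_one, Fin.forall_fin_two]
    refine ⟨⟨?_, ?_⟩, ?_, ?_⟩ <;>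
      nlinarith [sq_nonneg ‖p.1 0‖, sq_nonneg ‖p.1 1‖, sq_nonneg ‖p.2 0‖, sq_nonneg ‖p.2 1‖]
  have hne : S.Nonempty := ⟨(Pi.single 0 1, 0), by simp [S, q]⟩
  obtain ⟨p₀, hp₀, hmax⟩ := hS.exists_isMaxOn hne hb.continuousOn
  refine ⟨b p₀, strict_bound hΛ _ _ hp₀, fun x y => ?_⟩
  have hnn : 0 ≤ q (x, y) := by positivity
  rcases hnn.eq_or_lt with h0 | hpos
  · have hq0 : (∑ i, ‖x i‖ ^ 2) + ∑ j, ‖y j‖ ^ 2 = 0 := h0.symm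
    have hx : x = 0 := by
      have h1 : ∑ i, ‖x i‖ ^ 2 = 0 := by
        have : 0 ≤ ∑ j, ‖y j‖ ^ 2 := by positivity
        have : 0 ≤ ∑ i, ‖x i‖ ^ 2 := by positivity
        linarith
      rw [Finset.sum_eq_zero_iff_of_nonneg (fun _ _ => by positivity)] at h1
      ext i; simpa using h1 i (Finset.mem_univ i)
    rw [hq0]; simp [hx]
  · set r : ℝ := (Real.sqrt (q (x, y)))⁻¹
    have hr : r ^ 2 = (q (x, y))⁻¹ := by simp [r, inv_pow, Real.sq_sqrt hnn]
    have hscale_q : q ((r : ℂ) • x, (r : ℂ) • y) = r ^ 2 * q (x, y) := by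
      simp only [q, Pi.smul_apply, smul_eq_mul, norm_mul, mul_pow, Complex.norm_real,
        Real.norm_eq_abs, sq_abs, Finset.mul_sum, mul_add]
    have hscale_b : b ((r : ℂ) • x, (r : ℂ) • y) = r ^ 2 * b (x, y) := by
      have : (∑ i, ∑ j, Λ i j * (((r : ℂ) • x) i * ((r : ℂ) • y) j)) =
          ((r ^ 2 : ℝ) : ℂ) * ∑ i, ∑ j, Λ i j * (x i * y j) := by
        simp only [Fin.sum_univ_two, Pi.smul_apply, smul_eq_mul]; push_cast; ring
      simp only [b, this, Complex.re_ofReal_mul]; ring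
    have hmem : ((r : ℂ) • x, (r : ℂ) • y) ∈ S := by
      simp only [S, Set.mem_preimage, Set.mem_singleton_iff]
      rw [hscale_q, hr, inv_mul_cancel₀ hpos.ne']
    have h1 : b ((r : ℂ) • x, (r : ℂ) • y) ≤ b p₀ := hmax hmem
    rw [hscale_b, hr, inv_mul_le_iff₀ hpos] at h1
    change b (x, y) ≤ b p₀ * q (x, y)
    linarith

lemma memLp_cohFun (n : ℕ) {Λ : Fin 2 → Fin 2 → ℂ} (hΛ : Λ ∈ domain) :
    MemLp (cohFun n Λ) 2 (gaussian n) := by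
  have hc := (differentiable_cohFun n Λ).continuous
  obtain ⟨s, hs, hb⟩ := uniform_bound hΛ
  have hsq := continuous_sqNorm n
  rw [memLp_two_iff_integrable_sq_norm hc.aestronglyMeasurable, gaussian,
    integrable_withDensity_iff (by fun_prop) (by simp)]
  have h := (integrable_exp_neg_sqNorm n (sub_pos.2 hs)).const_mul
    ((gap Λ ^ ((n : ℝ) / 2)) ^ 2 * (Real.pi ^ (4 * n))⁻¹)
  refine h.mono' (Continuous.aestronglyMeasurable ?_) (Eventually.of_forall fun p => ?_)
  · simp only [ENNReal.toReal_ofReal (density_pos _).le]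
    fun_prop
  rw [ENNReal.toReal_ofReal (density_pos _).le, Real.norm_of_nonneg (by positivity)]
  have h1 : ‖cohFun n Λ p‖ ^ 2 = (gap Λ ^ ((n : ℝ) / 2)) ^ 2 *
      Real.exp (2 * (∑ i, ∑ j, Λ i j * Z p i j).re) := by
    rw [cohFun, norm_mul, mul_pow, Complex.norm_real, Real.norm_eq_abs, sq_abs, Complex.norm_exp,
      ← Real.exp_nat_mul]
    norm_num
  have h2 : 2 * (∑ i, ∑ j, Λ i j * Z p i j).re ≤ s * sqNorm p := by
    have h3 : ∑ i, ∑ j, Λ i j * Z p i j = ∑ k, ∑ i, ∑ j, Λ i j * (p.1 k i * p.2 k j) := by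
      simp only [Z, Fin.sum_univ_two, Finset.mul_sum, Finset.sum_add_distrib]
    rw [h3, Complex.re_sum, Finset.mul_sum, sqNorm, ← Finset.sum_add_distrib, Finset.mul_sum]
    exact Finset.sum_le_sum fun k _ => hb _ _
  rw [h1]
  calc _ = (gap Λ ^ ((n : ℝ) / 2)) ^ 2 * (Real.pi ^ (4 * n))⁻¹ *
        Real.exp (2 * (∑ i, ∑ j, Λ i j * Z p i j).re + -sqNorm p) := by rw [Real.exp_add]; ring
    _ ≤ _ := by
      gcongr
      linarith

open Classical in
/-- The coherent state `|Λ, n⟩` for `Λ` in the domain (and `0` elsewhere). -/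
def coherent (n : ℕ) (Λ : Fin 2 → Fin 2 → ℂ) : Fock n :=
  if h : Λ ∈ domain then
    (⟨(memLp_cohFun n h).toLp, cohFun n Λ, differentiable_cohFun n Λ,
      (memLp_cohFun n h).coeFn_toLp⟩ : fockSubmodule n)
  else 0

/-- The invariant measure
`dμ_n = (n-1)(n-2)²(n-3) / (π⁴ det (1 - Λ Λ†)⁴) ∏_{i,j} d(Re Λ_{i,j}) d(Im Λ_{i,j})` on the
domain. -/
def invMeasure (n : ℕ) : Measure (Fin 2 → Fin 2 → ℂ) :=
  (volume.restrict domain).withDensity fun Λ => ENNReal.ofReal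
    (((n : ℝ) - 1) * ((n : ℝ) - 2) ^ 2 * ((n : ℝ) - 3) / (Real.pi ^ 4 * gap Λ ^ 4))

/-- The projector `|Λ, n⟩⟨Λ, n|`. -/
def projector (n : ℕ) (Λ : Fin 2 → Fin 2 → ℂ) : Fock n →L[ℂ] Fock n :=
  InnerProductSpace.rankOne ℂ (coherent n Λ) (coherent n Λ)

/-- The operator `∫_{𝒟_η} |Λ, n⟩⟨Λ, n| dμ_n(Λ)`, as a Bochner integral for the operator norm; where
the integrand is integrable this is also the integral in the weak operator topology. -/
def cutOperator (n : ℕ) (η : ℝ) : Fock n →L[ℂ] Fock n :=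
  ∫ Λ in cutDomain η, projector n Λ ∂(invMeasure n)

/-! ### The trace -/

section Trace

variable {H : Type*} [NormedAddCommGroup H] [InnerProductSpace ℂ H] [CompleteSpace H]

/-- A bounded operator `A` is of trace class if `∑ᵢ ⟨eᵢ, |A| eᵢ⟩ < ∞` for every orthonormal basis,
where `|A| = (A† A)^{1/2}`. -/
def IsTraceClass (A : H →L[ℂ] H) : Prop :=
  ∀ (w : Set H) (b : HilbertBasis w ℂ H), Summable fun i => inner ℂ (b i) (CFC.abs A (b i))

/-- `A` has trace `t`: for every orthonormal basis, `∑ᵢ ⟨eᵢ, A eᵢ⟩ = t`. -/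
def HasTrace (A : H →L[ℂ] H) (t : ℂ) : Prop :=
  ∀ (w : Set H) (b : HilbertBasis w ℂ H), HasSum (fun i => inner ℂ (b i) (A (b i))) t

end Trace

end SU22
end

/-!
The operator `A = ∫ |ψ⟩⟨ψ|` of a square integrable family of vectors is positive, and by Parseval
and Tonelli its trace in any orthonormal basis is `∫ ‖ψ‖²`. Coherent states are unit vectors, so the
trace in question is the volume `μ_n(𝒟_η)`.

*Norm.* The integral of `exp (2 Re ∑ Λᵢⱼ Zᵢⱼ - |z|² - |z'|²)` splits over `k`. Integrating out `z'`
leaves the Gaussian of the Hermitian form `1 - Λ Λ†`, so each factor is `π⁴ / det (1 - Λ Λ†)`.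

*Continuity.* The coherent states converge pointwise and have constant norm, so by Fatou's lemma and
the parallelogram law they converge in `L²`.

*Volume.* By unitary invariance a second row `v` of `Λ` enters only through its components along and
across the first row, which turns the integral over `Λ` into one over `x = |row 1|²` and the squared
moduli `y`, `w` of these components. Trading `(y, w)` for the eigenvalues `a > b` of `Λ Λ†`, which
interlace `x`, and integrating out `x` in `(b, a)` yields the weight `π⁴ (a - b)²`. In terms of
`t = a / (1 - a)` and `t' = b / (1 - b)` the density `(1 - a)⁻⁴ (1 - b)⁻⁴ (a - b)²` becomes
`(t - t')²`, whose integral over `0 < t' < t < η / (1 - η)` is `(η / (1 - η))⁴ / 12`.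

*Bound.* With `m = n - 5` the trace is `(m + 4) (m + 3)² (m + 2) (K - m)⁴ / (192 m⁴)`, the prefactor
is at most `1 / 100`, and `(K - m)⁴ + m⁴ ≤ K⁴` leaves room for the extra `1`.
-/

noncomputable section

namespace SU22

section RankOne

open InnerProductSpace

variable {𝕜 H : Type*} [RCLike 𝕜] [NormedAddCommGroup H] [InnerProductSpace 𝕜 H]

lemma countable_of_orthonormal [SecondCountableTopology H] {ι : Type*} {v : ι → H}
    (hv : Orthonormal 𝕜 v) : Countable ι := by
  have one_le_dist : ∀ i j, i ≠ j → 1 ≤ dist (v i) (v j) := fun i j hij => by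
    have norm_sq : ‖v i - v j‖ ^ 2 = 2 := by
      rw [@norm_sub_sq 𝕜, hv.1 i, hv.1 j, hv.2 hij]
      norm_num
    rw [dist_eq_norm]
    nlinarith only [norm_nonneg (v i - v j), norm_sq]
  refine Set.countable_univ_iff.1 (Set.PairwiseDisjoint.countable_of_isOpen
    (s := fun i => Metric.ball (v i) (1 / 2)) (fun i _ j _ hij => ?_)
    (fun i _ => Metric.isOpen_ball) (fun i _ => Metric.nonempty_ball.2 (by norm_num)))
  exact Metric.ball_disjoint_ball (by linarith only [one_le_dist i j hij])

lemma hasSum_norm_inner_sq {ι : Type*} (b : HilbertBasis ι 𝕜 H) (x : H) :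
    HasSum (fun i => ‖inner 𝕜 (b i) x‖ ^ 2) (‖x‖ ^ 2) := by
  have parseval := b.hasSum_inner_mul_inner x x
  simp only [← inner_conj_symm x (b _), RCLike.conj_mul, inner_self_eq_norm_sq_to_K] at parseval
  exact_mod_cast parseval

lemma continuous_rankOne_self : Continuous fun x : H => rankOne 𝕜 x x := by
  simp only [rankOne_def']
  exact (ContinuousLinearMap.toSpanSingletonCLE (𝕜 := 𝕜) (E := H)).continuous.clm_comp
    (innerSL 𝕜).continuous

variable {α : Type*} {mα : MeasurableSpace α} {μ : Measure α} {ψ : α → H}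

lemma integrable_rankOne_self (hψ : MemLp ψ 2 μ) : Integrable (fun a => rankOne 𝕜 (ψ a) (ψ a)) μ :=
  ((memLp_two_iff_integrable_sq_norm hψ.1).1 hψ).mono'
    (continuous_rankOne_self.comp_aestronglyMeasurable hψ.1)
    (Eventually.of_forall fun a => by rw [norm_rankOne, sq])

end RankOne

section IntegralRankOne

open InnerProductSpace

variable {H : Type*} [NormedAddCommGroup H] [InnerProductSpace ℂ H] [CompleteSpace H]
  {α : Type*} {mα : MeasurableSpace α} {μ : Measure α} {ψ : α → H}

lemma inner_integral_rankOne_self (hψ : MemLp ψ 2 μ) (x : H) :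
    inner ℂ x ((∫ a, rankOne ℂ (ψ a) (ψ a) ∂μ) x) = ((∫ a, ‖inner ℂ x (ψ a)‖ ^ 2 ∂μ : ℝ) : ℂ) := by
  have hint := integrable_rankOne_self (𝕜 := ℂ) hψ
  rw [ContinuousLinearMap.integral_apply hint, ← integral_inner (hint.apply_continuousLinearMap x),
    ← integral_complex_ofReal]
  refine integral_congr_ae (Eventually.of_forall fun a => ?_)
  simp only [rankOne_apply, inner_smul_right, ← inner_conj_symm (ψ a) x, Complex.conj_mul',
    Complex.ofReal_pow]

lemma integral_rankOne_self_nonneg (hψ : MemLp ψ 2 μ) : 0 ≤ ∫ a, rankOne ℂ (ψ a) (ψ a) ∂μ := by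
  rw [ContinuousLinearMap.nonneg_iff_isPositive, ContinuousLinearMap.isPositive_iff_complex]
  intro x
  rw [← inner_conj_symm, inner_integral_rankOne_self hψ, Complex.conj_ofReal]
  exact ⟨rfl, integral_nonneg fun a => sq_nonneg _⟩

variable [SecondCountableTopology H]

theorem hasTrace_integral_rankOne_self (hψ : MemLp ψ 2 μ) :
    HasTrace (∫ a, rankOne ℂ (ψ a) (ψ a) ∂μ) ((∫ a, ‖ψ a‖ ^ 2 ∂μ : ℝ) : ℂ) := by
  intro w b
  have : Countable w := countable_of_orthonormal b.orthonormal
  simp only [inner_integral_rankOne_self hψ, Complex.hasSum_ofReal]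
  refine hasSum_integral_of_dominated_convergence (fun i a => ‖inner ℂ (b i) (ψ a)‖ ^ 2)
    (fun i => (by fun_prop : Continuous fun x : H => ‖inner ℂ (b i) x‖ ^ 2)
      |>.comp_aestronglyMeasurable hψ.1)
    (fun i => Eventually.of_forall fun a => (Real.norm_of_nonneg (sq_nonneg _)).le)
    (Eventually.of_forall fun a => (hasSum_norm_inner_sq b (ψ a)).summable) ?_
    (Eventually.of_forall fun a => hasSum_norm_inner_sq b (ψ a))
  simpa only [(hasSum_norm_inner_sq b (ψ _)).tsum_eq] using
    (memLp_two_iff_integrable_sq_norm hψ.1).1 hψ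

theorem isTraceClass_integral_rankOne_self (hψ : MemLp ψ 2 μ) :
    IsTraceClass (∫ a, rankOne ℂ (ψ a) (ψ a) ∂μ) := by
  intro w b
  rw [CFC.abs_of_nonneg _ (integral_rankOne_self_nonneg hψ)]
  exact (hasTrace_integral_rankOne_self hψ w b).summable

end IntegralRankOne

section SingularValues

open Set

lemma lintegral_comp_norm_sq {f : ℝ → ℝ≥0∞} (hf : Measurable f) :
    ∫⁻ z : ℂ, f (‖z‖ ^ 2) = ENNReal.ofReal Real.pi * ∫⁻ r in Ioi 0, f r := by
  have image_sq : (fun r : ℝ => r ^ 2) '' Ioi 0 = Ioi 0 := by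
    ext s
    exact ⟨fun ⟨r, hr, hrs⟩ => hrs ▸ pow_pos (mem_Ioi.1 hr) 2,
      fun hs => ⟨√s, Real.sqrt_pos.2 hs, Real.sq_sqrt (le_of_lt hs)⟩⟩
  have substitution : ∫⁻ r in Ioi 0, f r = ∫⁻ r in Ioi 0, ENNReal.ofReal (2 * r) * f (r ^ 2) := by
    conv_lhs => rw [← image_sq]
    refine lintegral_image_eq_lintegral_deriv_mul_of_monotoneOn measurableSet_Ioi
      (fun r _ => by simpa using (hasDerivAt_pow 2 r).hasDerivWithinAt)
      (fun r hr s _ hrs => pow_le_pow_left₀ (le_of_lt hr) hrs 2) f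
  have polar : ∫⁻ z : ℂ, f (‖z‖ ^ 2) =
      ∫⁻ p in Ioi 0 ×ˢ Ioo (-Real.pi) Real.pi, ENNReal.ofReal p.1 * f (p.1 ^ 2) := by
    rw [← Complex.lintegral_comp_polarCoord_symm]
    simp only [Complex.norm_polarCoord_symm, sq_abs, smul_eq_mul, polarCoord_target]
  rw [polar, Measure.volume_eq_prod, ← Measure.prod_restrict, lintegral_prod _ (by fun_prop),
    substitution, ← lintegral_const_mul _ (by fun_prop)]
  refine lintegral_congr fun r => ?_
  simp only [setLIntegral_const]
  rw [Real.volume_Ioo, sub_neg_eq_add, ← two_mul,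
    ENNReal.ofReal_mul zero_le_two, ENNReal.ofReal_mul zero_le_two]
  ring

lemma lintegral_Ioi_Ioi_comp_add {f : ℝ → ℝ≥0∞} (hf : Measurable f) :
    ∫⁻ s in Ioi 0, ∫⁻ t in Ioi 0, f (s + t) = ∫⁻ x in Ioi 0, ENNReal.ofReal x * f x := by
  have translate : ∀ s ∈ Ioi (0 : ℝ), ∫⁻ t in Ioi 0, f (s + t) =
      ∫⁻ x in Ioi 0, (Ioi s).indicator f x := fun s hs => by
    rw [setLIntegral_indicator measurableSet_Ioi, Ioi_inter_Ioi, sup_of_le_left (le_of_lt hs),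
      ← lintegral_indicator measurableSet_Ioi, ← lintegral_indicator measurableSet_Ioi,
      ← lintegral_add_left_eq_self ((Ioi s).indicator f) s]
    simp only [indicator, mem_Ioi, lt_add_iff_pos_right]
  have measurable_indicator : Measurable fun q : ℝ × ℝ => (Ioi q.1).indicator f q.2 :=
    (hf.comp measurable_snd).indicator (measurableSet_lt measurable_fst measurable_snd)
  rw [setLIntegral_congr_fun measurableSet_Ioi translate,
    lintegral_lintegral_swap measurable_indicator.aemeasurable]
  refine setLIntegral_congr_fun measurableSet_Ioi fun x _ => ?_
  have indicator_swap : ∀ s, (Ioi s).indicator f x = (Iio x).indicator (fun _ => f x) s :=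
    fun s => by simp only [indicator, mem_Ioi, mem_Iio]
  simp only [indicator_swap]
  rw [setLIntegral_indicator measurableSet_Iio, setLIntegral_const, Iio_inter_Ioi,
    Real.volume_Ioo, sub_zero, mul_comm]

lemma measurePreserving_mulVec {ι : Type*} [Fintype ι] [DecidableEq ι] {U : Matrix ι ι ℂ}
    (hU : ‖U.det‖ = 1) : MeasurePreserving (U.mulVec : (ι → ℂ) → ι → ℂ) := by
  set L : (ι → ℂ) →ₗ[ℝ] ι → ℂ := (Matrix.toLin' U).restrictScalars ℝ
  have det_eq_one : LinearMap.det L = 1 := by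
    rw [LinearMap.det_restrictScalars, LinearMap.det_toLin', Algebra.norm_complex_apply,
      normSq_eq_norm_sq, hU, one_pow]
  have map_eq := Measure.map_linearMap_addHaar_eq_smul_addHaar (volume : Measure (ι → ℂ)) (f := L)
    (by rw [det_eq_one]; exact one_ne_zero)
  refine ⟨L.continuous_of_finiteDimensional.measurable, ?_⟩
  rwa [det_eq_one, inv_one, abs_one, ENNReal.ofReal_one, one_smul] at map_eq

lemma ofReal_sum_norm_sq {ι : Type*} [Fintype ι] (w : ι → ℂ) :
    ((∑ i, ‖w i‖ ^ 2 : ℝ) : ℂ) = star w ⬝ᵥ w := by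
  simp only [dotProduct, Pi.star_apply, RCLike.star_def, Complex.conj_mul', ofReal_sum, ofReal_pow]

lemma sum_norm_sq_mulVec {ι : Type*} [Fintype ι] [DecidableEq ι] {U : Matrix ι ι ℂ}
    (hU : U ∈ Matrix.unitaryGroup ι ℂ) (v : ι → ℂ) :
    ∑ i, ‖(U.mulVec v) i‖ ^ 2 = ∑ i, ‖v i‖ ^ 2 := by
  rw [← Complex.ofReal_inj, ofReal_sum_norm_sq, ofReal_sum_norm_sq, Matrix.star_mulVec,
    Matrix.dotProduct_mulVec, Matrix.vecMul_vecMul, ← Matrix.star_eq_conjTranspose,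
    Matrix.mem_unitaryGroup_iff'.1 hU, Matrix.vecMul_one]

lemma exists_unitary_norm_det (r : Fin 2 → ℂ) : ∃ U ∈ Matrix.unitaryGroup (Fin 2) ℂ,
    ∀ v, ‖(Matrix.of ![r, v]).det‖ ^ 2 = (∑ j, ‖r j‖ ^ 2) * ‖U.mulVec v 1‖ ^ 2 := by
  rcases eq_or_ne r 0 with rfl | hr
  · exact ⟨1, one_mem _, fun v => by simp [Matrix.det_fin_two]⟩
  have norm_sq_pos : 0 < ‖r 0‖ ^ 2 + ‖r 1‖ ^ 2 := by
    rw [← Fin.sum_univ_two (fun j => ‖r j‖ ^ 2)]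
    obtain ⟨j, hj⟩ := Function.ne_iff.1 hr
    exact Finset.sum_pos' (fun _ _ => sq_nonneg _) ⟨j, Finset.mem_univ _, by positivity⟩
  set t : ℝ := (√(‖r 0‖ ^ 2 + ‖r 1‖ ^ 2))⁻¹
  have t_sq : t ^ 2 * (‖r 0‖ ^ 2 + ‖r 1‖ ^ 2) = 1 := by
    rw [inv_pow, Real.sq_sqrt norm_sq_pos.le, inv_mul_cancel₀ norm_sq_pos.ne']
  have t_sq_complex : (t : ℂ) ^ 2 * (r 0 * conj (r 0) + r 1 * conj (r 1)) = 1 := by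
    rw [Complex.mul_conj', Complex.mul_conj']
    exact_mod_cast t_sq
  refine ⟨!![t * conj (r 0), t * conj (r 1); -(t * r 1), t * r 0], ?_, fun v => ?_⟩
  · rw [Matrix.mem_unitaryGroup_iff]
    ext i j
    fin_cases i <;> fin_cases j <;>
      simp only [Matrix.mul_apply, Fin.sum_univ_two, Fin.isValue, Fin.zero_eta, Fin.mk_one,
        Matrix.of_apply, Matrix.cons_val', Matrix.cons_val_fin_one, Matrix.cons_val_zero,
        Matrix.cons_val_one, Matrix.star_apply, RCLike.star_def, map_mul, map_neg, conj_ofReal,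
        conj_conj, Matrix.one_apply_eq, ne_eq, zero_ne_one, one_ne_zero, not_false_eq_true,
        Matrix.one_apply_ne] <;>
      first | linear_combination t_sq_complex | ring
  · have snd_eq : (!![t * conj (r 0), t * conj (r 1); -(t * r 1), t * r 0]).mulVec v 1 =
        t * (Matrix.of ![r, v]).det := by
      simp only [Matrix.mulVec, dotProduct, Fin.isValue, Matrix.of_apply, Matrix.cons_val',
        Matrix.cons_val_fin_one, Matrix.cons_val_one, Fin.sum_univ_two, Matrix.cons_val_zero,
        neg_mul, Nat.succ_eq_add_one, Nat.reduceAdd, Matrix.det_fin_two]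
      ring
    rw [snd_eq, norm_mul, mul_pow, norm_real, Real.norm_eq_abs, sq_abs, Fin.sum_univ_two]
    linear_combination -‖(Matrix.of ![r, v]).det‖ ^ 2 * t_sq

lemma lintegral_comp_norm_sq_fin_two {F : ℝ → ℝ → ℝ≥0∞} (hF : Measurable (Function.uncurry F)) :
    ∫⁻ v : Fin 2 → ℂ, F (‖v 0‖ ^ 2) (‖v 1‖ ^ 2) =
      ENNReal.ofReal Real.pi ^ 2 * ∫⁻ y in Ioi 0, ∫⁻ w in Ioi 0, F y w := by
  have measurable_inner : Measurable fun y => ∫⁻ w in Ioi 0, F y w := hF.lintegral_prod_right'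
  calc ∫⁻ v : Fin 2 → ℂ, F (‖v 0‖ ^ 2) (‖v 1‖ ^ 2)
      = ∫⁻ p : ℂ × ℂ, Function.uncurry F (‖p.1‖ ^ 2, ‖p.2‖ ^ 2) :=
        (volume_preserving_finTwoArrow ℂ).lintegral_comp
          (f := fun p => Function.uncurry F (‖p.1‖ ^ 2, ‖p.2‖ ^ 2)) (by fun_prop)
    _ = ∫⁻ y : ℂ, ∫⁻ w : ℂ, F (‖y‖ ^ 2) (‖w‖ ^ 2) := by
        rw [Measure.volume_eq_prod, lintegral_prod _ (by fun_prop)]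
        rfl
    _ = ∫⁻ y : ℂ, ENNReal.ofReal Real.pi * ∫⁻ w in Ioi 0, F (‖y‖ ^ 2) w :=
        lintegral_congr fun y => lintegral_comp_norm_sq hF.of_uncurry_left
    _ = ENNReal.ofReal Real.pi ^ 2 * ∫⁻ y in Ioi 0, ∫⁻ w in Ioi 0, F y w := by
        rw [lintegral_comp_norm_sq (measurable_inner.const_mul _),
          lintegral_const_mul _ measurable_inner, sq, mul_assoc]

lemma lintegral_row_norm_sq_det {G : ℝ → ℝ → ℝ≥0∞} (hG : Measurable (Function.uncurry G))
    (r : Fin 2 → ℂ) :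
    ∫⁻ v : Fin 2 → ℂ, G (∑ j, ‖r j‖ ^ 2 + ∑ j, ‖v j‖ ^ 2) (‖(Matrix.of ![r, v]).det‖ ^ 2) =
      ENNReal.ofReal Real.pi ^ 2 * ∫⁻ y in Ioi 0, ∫⁻ w in Ioi 0,
        G (∑ j, ‖r j‖ ^ 2 + (y + w)) ((∑ j, ‖r j‖ ^ 2) * w) := by
  obtain ⟨U, hU, norm_det⟩ := exists_unitary_norm_det r
  set x := ∑ j, ‖r j‖ ^ 2
  have rotate : MeasurePreserving (U.mulVec : (Fin 2 → ℂ) → Fin 2 → ℂ) :=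
    measurePreserving_mulVec (CStarRing.norm_of_mem_unitary (Matrix.det_of_mem_unitary hU))
  have measurable_uncurry : Measurable (Function.uncurry fun y w => G (x + (y + w)) (x * w)) :=
    hG.comp (by fun_prop : Measurable fun p : ℝ × ℝ => (x + (p.1 + p.2), x * p.2))
  have measurable_comp : Measurable fun v : Fin 2 → ℂ =>
      G (x + (‖v 0‖ ^ 2 + ‖v 1‖ ^ 2)) (x * ‖v 1‖ ^ 2) :=
    measurable_uncurry.comp (by fun_prop : Measurable fun v : Fin 2 → ℂ => (‖v 0‖ ^ 2, ‖v 1‖ ^ 2))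
  rw [← lintegral_comp_norm_sq_fin_two measurable_uncurry, ← rotate.lintegral_comp measurable_comp]
  refine lintegral_congr fun v => ?_
  rw [norm_det, ← sum_norm_sq_mulVec hU, Fin.sum_univ_two (fun j => ‖U.mulVec v j‖ ^ 2)]

lemma lintegral_matrix_norm_sq_det {G : ℝ → ℝ → ℝ≥0∞} (hG : Measurable (Function.uncurry G)) :
    ∫⁻ Λ : Fin 2 → Fin 2 → ℂ, G (∑ i, ∑ j, ‖Λ i j‖ ^ 2) (‖(Matrix.of Λ).det‖ ^ 2) =
      ENNReal.ofReal Real.pi ^ 4 * ∫⁻ x in Ioi 0, ENNReal.ofReal x *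
        ∫⁻ y in Ioi 0, ∫⁻ w in Ioi 0, G (x + (y + w)) (x * w) := by
  set I : ℝ → ℝ≥0∞ := fun x => ∫⁻ y in Ioi 0, ∫⁻ w in Ioi 0, G (x + (y + w)) (x * w)
  have measurable_I : Measurable I := by
    have h := hG.comp (by fun_prop : Measurable fun p : (ℝ × ℝ) × ℝ =>
      (p.1.1 + (p.1.2 + p.2), p.1.1 * p.2))
    exact (h.lintegral_prod_right').lintegral_prod_right'
  set g : (Fin 2 → ℂ) × (Fin 2 → ℂ) → ℝ≥0∞ := fun p =>
    G (∑ j, ‖p.1 j‖ ^ 2 + ∑ j, ‖p.2 j‖ ^ 2) (‖(Matrix.of ![p.1, p.2]).det‖ ^ 2)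
  have measurable_g : Measurable g := by
    refine hG.comp (by fun_prop : Measurable fun p : (Fin 2 → ℂ) × (Fin 2 → ℂ) =>
      (∑ j, ‖p.1 j‖ ^ 2 + ∑ j, ‖p.2 j‖ ^ 2, ‖(Matrix.of ![p.1, p.2]).det‖ ^ 2))
  calc ∫⁻ Λ : Fin 2 → Fin 2 → ℂ, G (∑ i, ∑ j, ‖Λ i j‖ ^ 2) (‖(Matrix.of Λ).det‖ ^ 2)
      = ∫⁻ p, g p := by
        rw [← (volume_preserving_finTwoArrow (Fin 2 → ℂ)).lintegral_comp measurable_g]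
        refine lintegral_congr fun Λ => ?_
        have cons_rows : ![Λ 0, Λ 1] = Λ := by
          ext i
          fin_cases i <;> rfl
        rw [Fin.sum_univ_two (fun i => ∑ j, ‖Λ i j‖ ^ 2)]
        exact congrArg (fun A => G _ (‖(Matrix.of A).det‖ ^ 2)) cons_rows.symm
    _ = ∫⁻ r : Fin 2 → ℂ, ENNReal.ofReal Real.pi ^ 2 * I (‖r 0‖ ^ 2 + ‖r 1‖ ^ 2) := by
        rw [Measure.volume_eq_prod, lintegral_prod _ measurable_g.aemeasurable]
        refine lintegral_congr fun r => ?_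
        rw [← Fin.sum_univ_two (fun j => ‖r j‖ ^ 2), ← lintegral_row_norm_sq_det hG]
    _ = ENNReal.ofReal Real.pi ^ 4 * ∫⁻ x in Ioi 0, ENNReal.ofReal x * I x := by
        rw [lintegral_const_mul' _ _ (by simp), lintegral_comp_norm_sq_fin_two
          (F := fun y w => I (y + w)) (measurable_I.comp (by fun_prop)),
          lintegral_Ioi_Ioi_comp_add measurable_I]
        ring

/-- The change of variables `(a, b) ↦ (y, w)` with `x + y + w = a + b` and `x w = a b`. As
`x y = (a - x) (x - b)`, it identifies the region `b < x < a` with the quadrant `y, w > 0`: here `x`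
is the squared norm of a row and `a`, `b` are the squared singular values of the matrix. -/
def interlacingMap (x : ℝ) (p : ℝ × ℝ) : ℝ × ℝ := ((p.1 - x) * (x - p.2) / x, p.1 * p.2 / x)

lemma image_interlacingMap {x : ℝ} (hx : 0 < x) :
    interlacingMap x '' (Ioi x ×ˢ Ioo 0 x) = Ioi 0 ×ˢ Ioi 0 := by
  ext ⟨y, w⟩
  constructor
  · rintro ⟨⟨a, b⟩, ⟨ha : x < a, hb : 0 < b, hbx : b < x⟩, hab⟩
    obtain ⟨rfl, rfl⟩ := Prod.mk.inj hab
    exact ⟨div_pos (mul_pos (sub_pos.2 ha) (sub_pos.2 hbx)) hx,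
      div_pos (mul_pos (hx.trans ha) hb) hx⟩
  rintro ⟨hy : 0 < y, hw : 0 < w⟩
  set s := x + (y + w)
  have discrim_pos : 0 < s ^ 2 - 4 * (x * w) := by
    have discrim_eq : s ^ 2 - 4 * (x * w) = (x - w) ^ 2 + y * (y + 2 * x + 2 * w) := by ring
    rw [discrim_eq]
    positivity
  set d := √(s ^ 2 - 4 * (x * w))
  have d_sq : d ^ 2 = s ^ 2 - 4 * (x * w) := Real.sq_sqrt discrim_pos.le
  have d_pos : 0 < d := Real.sqrt_pos.2 discrim_pos
  have d_lt : d < s := by nlinarith only [mul_pos hx hw, d_sq, d_pos, hx, hy, hw]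
  have mul_sub_root : ((s + d) / 2 - x) * (x - (s - d) / 2) = x * y := by
    linear_combination (1 / 4 : ℝ) * d_sq
  have lt_root : x < (s + d) / 2 := by nlinarith only [mul_pos hx hy, mul_sub_root, d_pos]
  have root_lt : (s - d) / 2 < x := by nlinarith only [mul_pos hx hy, mul_sub_root, d_pos]
  refine ⟨((s + d) / 2, (s - d) / 2), ⟨lt_root, half_pos (sub_pos.2 d_lt), root_lt⟩,
    Prod.ext ?_ ?_⟩
  · rw [interlacingMap, mul_sub_root, mul_div_cancel_left₀ _ hx.ne']
  · rw [interlacingMap, div_eq_iff hx.ne']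
    linear_combination -(1 / 4 : ℝ) * d_sq

lemma injOn_interlacingMap {x : ℝ} (hx : x ≠ 0) : InjOn (interlacingMap x) (Ioi x ×ˢ Iio x) := by
  rintro ⟨a, b⟩ ⟨ha : x < a, _⟩ ⟨a', b'⟩ ⟨_, hb' : b' < x⟩ h
  obtain ⟨sub_eq, mul_eq⟩ := Prod.mk.inj h
  rw [div_left_inj' hx] at sub_eq mul_eq
  have add_eq : a + b = a' + b' := mul_left_cancel₀ hx (by linear_combination sub_eq + mul_eq)
  have root : (a - a') * (a - b') = 0 := by linear_combination a * add_eq - mul_eq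
  have fst_eq : a = a' := by rcases mul_eq_zero.1 root with h | h <;> linarith only [h, ha, hb']
  exact Prod.ext fst_eq (by linarith only [fst_eq, add_eq])

/-- The differential of `interlacingMap x` at `p`. -/
def fderivInterlacingMap (x : ℝ) (p : ℝ × ℝ) : ℝ × ℝ →L[ℝ] ℝ × ℝ :=
  (Matrix.toLin (.finTwoProd ℝ) (.finTwoProd ℝ)
    !![(x - p.2) / x, -(p.1 - x) / x; p.2 / x, p.1 / x]).toContinuousLinearMap

lemma hasFDerivAt_interlacingMap (x : ℝ) (p : ℝ × ℝ) :
    HasFDerivAt (interlacingMap x) (fderivInterlacingMap x p) p := by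
  have hfst : HasFDerivAt Prod.fst (ContinuousLinearMap.fst ℝ ℝ ℝ) p := hasFDerivAt_fst
  have hsnd : HasFDerivAt Prod.snd (ContinuousLinearMap.snd ℝ ℝ ℝ) p := hasFDerivAt_snd
  rw [fderivInterlacingMap, Matrix.toLin_finTwoProd_toContinuousLinearMap]
  refine HasFDerivAt.congr_fderiv (HasFDerivAt.prodMk
    (((hfst.sub_const x).mul (hsnd.const_sub x)).mul_const x⁻¹)
    ((hfst.mul hsnd).mul_const x⁻¹)) ?_
  ext <;> simp <;> ring

lemma det_fderivInterlacingMap {x : ℝ} (hx : x ≠ 0) (p : ℝ × ℝ) :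
    (fderivInterlacingMap x p).det = (p.1 - p.2) / x := by
  simp only [fderivInterlacingMap, LinearMap.det_toContinuousLinearMap, LinearMap.det_toLin,
    Matrix.det_fin_two_of]
  field_simp
  ring

lemma lintegral_quadrant_interlacing {x : ℝ} (hx : 0 < x) (G : ℝ → ℝ → ℝ≥0∞) :
    ∫⁻ p in Ioi (0 : ℝ) ×ˢ Ioi (0 : ℝ), G (x + (p.1 + p.2)) (x * p.2) =
      ∫⁻ p in Ioi x ×ˢ Ioo 0 x, ENNReal.ofReal ((p.1 - p.2) / x) * G (p.1 + p.2) (p.1 * p.2) := by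
  rw [← image_interlacingMap hx, lintegral_image_eq_lintegral_abs_det_fderiv_mul volume
    (measurableSet_Ioi.prod measurableSet_Ioo)
    (fun p _ => (hasFDerivAt_interlacingMap x p).hasFDerivWithinAt)
    ((injOn_interlacingMap hx.ne').mono (prod_mono_right Ioo_subset_Iio_self))]
  refine setLIntegral_congr_fun (measurableSet_Ioi.prod measurableSet_Ioo) ?_
  rintro ⟨a, b⟩ ⟨ha : x < a, -, hb : b < x⟩
  have sum_eq : x + ((a - x) * (x - b) / x + a * b / x) = a + b := by
    field_simp
    ring
  simp only [det_fderivInterlacingMap hx.ne', interlacingMap, sum_eq,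
    mul_div_cancel₀ _ hx.ne', abs_of_pos (div_pos (sub_pos.2 (hb.trans ha)) hx)]

lemma ofReal_mul_lintegral_quadrant_interlacing {x : ℝ} (hx : 0 < x) (G : ℝ → ℝ → ℝ≥0∞) :
    ENNReal.ofReal x * ∫⁻ p in Ioi (0 : ℝ) ×ˢ Ioi (0 : ℝ), G (x + (p.1 + p.2)) (x * p.2) =
      ∫⁻ p in Ioi (0 : ℝ) ×ˢ Ioi (0 : ℝ), (Ioo p.2 p.1).indicator
        (fun _ => ENNReal.ofReal (p.1 - p.2) * G (p.1 + p.2) (p.1 * p.2)) x := by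
  have region : Ioi x ×ˢ Ioo 0 x = {p | x ∈ Ioo p.2 p.1} ∩ Ioi (0 : ℝ) ×ˢ Ioi (0 : ℝ) := by
    ext p
    simp only [mem_prod, mem_Ioi, mem_Ioo, mem_inter_iff, mem_ofPred_eq]
    grind
  have measurable_region : MeasurableSet {p : ℝ × ℝ | x ∈ Ioo p.2 p.1} :=
    (measurableSet_lt measurable_snd measurable_const).inter
      (measurableSet_lt measurable_const measurable_fst)
  rw [lintegral_quadrant_interlacing hx, ← lintegral_const_mul' _ _ ENNReal.ofReal_ne_top,
    region, ← setLIntegral_indicator measurable_region]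
  refine lintegral_congr fun p => ?_
  simp only [indicator, mem_ofPred_eq, ← mul_assoc, ← ENNReal.ofReal_mul hx.le,
    mul_div_cancel₀ _ hx.ne']

lemma lintegral_row_interlacing {G : ℝ → ℝ → ℝ≥0∞} (hG : Measurable (Function.uncurry G)) :
    ∫⁻ x in Ioi (0 : ℝ), ENNReal.ofReal x *
        ∫⁻ p in Ioi (0 : ℝ) ×ˢ Ioi (0 : ℝ), G (x + (p.1 + p.2)) (x * p.2) =
      ∫⁻ p in Ioi (0 : ℝ) ×ˢ Ioi (0 : ℝ),
        ENNReal.ofReal (p.1 - p.2) ^ 2 * G (p.1 + p.2) (p.1 * p.2) := by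
  have measurable_comp : Measurable fun p : ℝ × ℝ => G (p.1 + p.2) (p.1 * p.2) :=
    hG.comp (by fun_prop : Measurable fun p : ℝ × ℝ => (p.1 + p.2, p.1 * p.2))
  have measurable_indicator : Measurable fun q : ℝ × (ℝ × ℝ) => (Ioo q.2.2 q.2.1).indicator
      (fun _ => ENNReal.ofReal (q.2.1 - q.2.2) * G (q.2.1 + q.2.2) (q.2.1 * q.2.2)) q.1 :=
    Measurable.indicator (Measurable.mul (by fun_prop) (measurable_comp.comp measurable_snd))
      ((measurableSet_lt (measurable_snd.comp measurable_snd) measurable_fst).inter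
        (measurableSet_lt measurable_fst (measurable_fst.comp measurable_snd)))
  rw [setLIntegral_congr_fun measurableSet_Ioi
      (fun x hx => ofReal_mul_lintegral_quadrant_interlacing hx G),
    lintegral_lintegral_swap measurable_indicator.aemeasurable]
  refine setLIntegral_congr_fun (measurableSet_Ioi.prod measurableSet_Ioi) fun p hp => ?_
  have Ioo_inter : Ioo p.2 p.1 ∩ Ioi 0 = Ioo p.2 p.1 :=
    inter_eq_left.2 fun x hx => lt_trans hp.2 hx.1
  rw [setLIntegral_indicator measurableSet_Ioo, setLIntegral_const, Ioo_inter, Real.volume_Ioo]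
  ring

lemma lintegral_matrix_singularValues {G : ℝ → ℝ → ℝ≥0∞}
    (hG : Measurable (Function.uncurry G)) :
    ∫⁻ Λ : Fin 2 → Fin 2 → ℂ, G (∑ i, ∑ j, ‖Λ i j‖ ^ 2) (‖(Matrix.of Λ).det‖ ^ 2) =
      ENNReal.ofReal Real.pi ^ 4 * ∫⁻ a in Ioi 0, ∫⁻ b in Ioo 0 a,
        ENNReal.ofReal (a - b) ^ 2 * G (a + b) (a * b) := by
  have measurable_row : ∀ x, Measurable fun p : ℝ × ℝ => G (x + (p.1 + p.2)) (x * p.2) := fun x =>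
    hG.comp (by fun_prop : Measurable fun p : ℝ × ℝ => (x + (p.1 + p.2), x * p.2))
  have measurable_comp : Measurable fun p : ℝ × ℝ => G (p.1 + p.2) (p.1 * p.2) :=
    hG.comp (by fun_prop : Measurable fun p : ℝ × ℝ => (p.1 + p.2, p.1 * p.2))
  have row_eq_prod : ∀ x, ∫⁻ y in Ioi 0, ∫⁻ w in Ioi 0, G (x + (y + w)) (x * w) =
      ∫⁻ p in Ioi (0 : ℝ) ×ˢ Ioi (0 : ℝ), G (x + (p.1 + p.2)) (x * p.2) := fun x => by
    rw [Measure.volume_eq_prod, ← Measure.prod_restrict,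
      lintegral_prod _ (measurable_row x).aemeasurable]
  have measurable_weighted : Measurable fun p : ℝ × ℝ =>
      ENNReal.ofReal (p.1 - p.2) ^ 2 * G (p.1 + p.2) (p.1 * p.2) :=
    Measurable.mul (by fun_prop) measurable_comp
  have truncate : ∀ a b : ℝ, ENNReal.ofReal (a - b) ^ 2 * G (a + b) (a * b) =
      (Iio a).indicator (fun b => ENNReal.ofReal (a - b) ^ 2 * G (a + b) (a * b)) b := fun a b => by
    rcases lt_or_ge b a with hba | hab
    · rw [indicator_of_mem (mem_Iio.2 hba)]
    · rw [indicator_of_notMem (notMem_Iio.2 hab), ENNReal.ofReal_of_nonpos (sub_nonpos.2 hab),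
        zero_pow two_ne_zero, zero_mul]
  rw [lintegral_matrix_norm_sq_det hG]
  simp only [row_eq_prod]
  rw [lintegral_row_interlacing hG, Measure.volume_eq_prod, ← Measure.prod_restrict,
    lintegral_prod _ measurable_weighted.aemeasurable]
  congr 1
  refine lintegral_congr fun a => ?_
  rw [lintegral_congr (truncate a), setLIntegral_indicator measurableSet_Iio, Iio_inter_Ioi]

end SingularValues

section CutDomain

open Set

lemma posSemidef_fin_two_iff {𝕜 : Type*} [RCLike 𝕜] {A : Matrix (Fin 2) (Fin 2) 𝕜}
    (hA : A.IsHermitian) : A.PosSemidef ↔ 0 ≤ A.trace ∧ 0 ≤ A.det := by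
  rw [hA.posSemidef_iff_eigenvalues_nonneg, hA.trace_eq_sum_eigenvalues,
    hA.det_eq_prod_eigenvalues, Fin.sum_univ_two, Fin.prod_univ_two, ← RCLike.ofReal_add,
    ← RCLike.ofReal_mul, RCLike.ofReal_nonneg, RCLike.ofReal_nonneg, Pi.le_def, Fin.forall_fin_two]
  simp only [Pi.zero_apply]
  exact ⟨fun h => ⟨add_nonneg h.1 h.2, mul_nonneg h.1 h.2⟩, fun h => by
    rcases mul_nonneg_iff.1 h.2 with h' | h'
    · exact h'
    · constructor <;> linarith only [h.1, h']⟩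

lemma trace_smul_one_sub (t : ℝ) (Λ : Fin 2 → Fin 2 → ℂ) :
    ((t : ℂ) • 1 - Matrix.of Λ * (Matrix.of Λ).conjTranspose).trace =
      (2 * t - ∑ i, ∑ j, ‖Λ i j‖ ^ 2 : ℝ) := by
  simp only [coe_smul, Matrix.trace_sub, Matrix.trace_smul, Matrix.trace_one, Fintype.card_fin,
    Nat.cast_ofNat, real_smul, Matrix.trace_fin_two, Fin.isValue, Matrix.mul_apply, Matrix.of_apply,
    Matrix.conjTranspose_apply, RCLike.star_def, mul_conj', Fin.sum_univ_two, ofReal_sub,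
    ofReal_mul, ofReal_ofNat, ofReal_add, ofReal_pow, sub_left_inj]
  ring

lemma det_smul_one_sub (t : ℝ) (Λ : Fin 2 → Fin 2 → ℂ) :
    ((t : ℂ) • 1 - Matrix.of Λ * (Matrix.of Λ).conjTranspose).det =
      (t ^ 2 - t * ∑ i, ∑ j, ‖Λ i j‖ ^ 2 + ‖(Matrix.of Λ).det‖ ^ 2 : ℝ) := by
  simp only [coe_smul, Matrix.det_fin_two, Fin.isValue, Matrix.sub_apply, Matrix.smul_apply,
    Matrix.one_apply_eq, real_smul, mul_one, Matrix.mul_apply, Matrix.of_apply,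
    Matrix.conjTranspose_apply, RCLike.star_def, Fin.sum_univ_two, ne_eq, zero_ne_one,
    not_false_eq_true, Matrix.one_apply_ne, smul_zero, zero_sub, neg_add_rev, one_ne_zero,
    ofReal_add, ofReal_sub, ofReal_pow, ofReal_mul, ← mul_conj', map_sub, map_mul]
  ring

lemma mem_cutDomain_iff {η : ℝ} {Λ : Fin 2 → Fin 2 → ℂ} :
    Λ ∈ cutDomain η ↔ 0 ≤ 2 * η - ∑ i, ∑ j, ‖Λ i j‖ ^ 2 ∧
      0 ≤ η ^ 2 - η * ∑ i, ∑ j, ‖Λ i j‖ ^ 2 + ‖(Matrix.of Λ).det‖ ^ 2 := by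
  have isHermitian : ((η : ℂ) • 1 - Matrix.of Λ * (Matrix.of Λ).conjTranspose).IsHermitian :=
    (Matrix.isHermitian_one.smul (conj_ofReal η)).sub (Matrix.isHermitian_mul_conjTranspose_self _)
  rw [cutDomain, mem_ofPred_eq, posSemidef_fin_two_iff isHermitian, trace_smul_one_sub,
    det_smul_one_sub, Complex.zero_le_real, Complex.zero_le_real]

lemma gap_eq (Λ : Fin 2 → Fin 2 → ℂ) :
    gap Λ = 1 - ∑ i, ∑ j, ‖Λ i j‖ ^ 2 + ‖(Matrix.of Λ).det‖ ^ 2 := by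
  have det_eq := det_smul_one_sub 1 Λ
  rw [ofReal_one, one_smul] at det_eq
  rw [gap, det_eq, ofReal_re, one_pow, one_mul]

lemma continuous_gap : Continuous gap := by
  simp only [funext gap_eq]
  fun_prop

lemma gap_pos {Λ : Fin 2 → Fin 2 → ℂ} (hΛ : Λ ∈ domain) : 0 < gap Λ :=
  (Complex.pos_iff.1 (Matrix.PosDef.det_pos hΛ)).1

lemma isClosed_cutDomain (η : ℝ) : IsClosed (cutDomain η) := by
  have eq_inter : cutDomain η = {Λ | 0 ≤ 2 * η - ∑ i, ∑ j, ‖Λ i j‖ ^ 2} ∩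
      {Λ | 0 ≤ η ^ 2 - η * ∑ i, ∑ j, ‖Λ i j‖ ^ 2 + ‖(Matrix.of Λ).det‖ ^ 2} :=
    Set.ext fun _ => mem_cutDomain_iff
  rw [eq_inter]
  exact (isClosed_le continuous_const (by fun_prop)).inter
    (isClosed_le continuous_const (by fun_prop))

lemma cutDomain_subset_domain {η : ℝ} (hη : η < 1) : cutDomain η ⊆ domain := by
  intro Λ hΛ
  have posDef : (((1 - η : ℝ) : ℂ) • (1 : Matrix (Fin 2) (Fin 2) ℂ)).PosDef :=
    Matrix.PosDef.one.smul (Complex.zero_lt_real.2 (sub_pos.2 hη))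
  have sum_eq : ((1 - η : ℝ) : ℂ) • (1 : Matrix (Fin 2) (Fin 2) ℂ) +
      ((η : ℂ) • 1 - Matrix.of Λ * (Matrix.of Λ).conjTranspose) =
        1 - Matrix.of Λ * (Matrix.of Λ).conjTranspose := by
    push_cast
    module
  have posDef_add := posDef.add_posSemidef hΛ
  rwa [sum_eq] at posDef_add

lemma trace_det_nonneg_iff {η a b : ℝ} (hba : b < a) :
    0 ≤ 2 * η - (a + b) ∧ 0 ≤ η ^ 2 - η * (a + b) + a * b ↔ a ≤ η := by
  constructor
  · rintro ⟨trace_nonneg, det_nonneg⟩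
    by_contra! hηa
    nlinarith only [trace_nonneg, det_nonneg, hηa, hba]
  · intro haη
    constructor <;> nlinarith only [haη, hba]

lemma lintegral_cutDomain_comp_gap (η : ℝ) {f : ℝ → ℝ≥0∞} (hf : Measurable f) :
    ∫⁻ Λ in cutDomain η, f (gap Λ) = ENNReal.ofReal Real.pi ^ 4 * ∫⁻ a in Ioc 0 η,
      ∫⁻ b in Ioo 0 a, ENNReal.ofReal (a - b) ^ 2 * f ((1 - a) * (1 - b)) := by
  set cut : Set (ℝ × ℝ) := {q | 0 ≤ 2 * η - q.1} ∩ {q | 0 ≤ η ^ 2 - η * q.1 + q.2}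
  have isClosed_cut : IsClosed cut :=
    (isClosed_le continuous_const (by fun_prop)).inter
      (isClosed_le continuous_const (by fun_prop))
  have mem_cut_iff : ∀ {a b : ℝ}, b < a → ((a + b, a * b) ∈ cut ↔ a ≤ η) := trace_det_nonneg_iff
  set G : ℝ → ℝ → ℝ≥0∞ := fun s d => cut.indicator (fun q => f (1 - q.1 + q.2)) (s, d)
  have measurable_G : Measurable (Function.uncurry G) :=
    Measurable.indicator (by fun_prop) isClosed_cut.measurableSet
  have indicator_eq : ∀ Λ, (cutDomain η).indicator (fun Λ => f (gap Λ)) Λ =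
      G (∑ i, ∑ j, ‖Λ i j‖ ^ 2) (‖(Matrix.of Λ).det‖ ^ 2) := fun Λ => by
    simp only [G, cut, indicator, mem_inter_iff, mem_cutDomain_iff, gap_eq, mem_ofPred_eq]
  have inner_eq : ∀ a, ∫⁻ b in Ioo 0 a, ENNReal.ofReal (a - b) ^ 2 * G (a + b) (a * b) =
      (Iic η).indicator (fun a =>
        ∫⁻ b in Ioo 0 a, ENNReal.ofReal (a - b) ^ 2 * f ((1 - a) * (1 - b))) a := fun a => by
    by_cases haη : a ∈ Iic η
    · rw [indicator_of_mem haη]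
      refine setLIntegral_congr_fun measurableSet_Ioo fun b hb => ?_
      simp only [G, indicator_of_mem ((mem_cut_iff hb.2).2 haη)]
      ring_nf
    · rw [indicator_of_notMem haη]
      refine setLIntegral_eq_zero measurableSet_Ioo fun b hb => ?_
      simp only [G, indicator_of_notMem (mt (mem_cut_iff hb.2).1 haη), mul_zero, Pi.zero_apply]
  rw [← lintegral_indicator (isClosed_cutDomain η).measurableSet, lintegral_congr indicator_eq,
    lintegral_matrix_singularValues measurable_G, lintegral_congr inner_eq,
    setLIntegral_indicator measurableSet_Iic, Iic_inter_Ioi]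

end CutDomain

section Volume

open Set

lemma lintegral_Ioc_of_hasDerivAt {F f : ℝ → ℝ} {a b : ℝ} (hab : a ≤ b)
    (hF : ∀ x ∈ Icc a b, HasDerivAt F (f x) x) (hf : ContinuousOn f (Icc a b))
    (hf_nonneg : ∀ x ∈ Icc a b, 0 ≤ f x) :
    ∫⁻ x in Ioc a b, ENNReal.ofReal (f x) = ENNReal.ofReal (F b - F a) := by
  rw [← uIcc_of_le hab] at hF hf
  have integrable : IntervalIntegrable f volume a b := hf.intervalIntegrable
  rw [← intervalIntegral.integral_eq_sub_of_hasDerivAt hF integrable,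
    intervalIntegral.integral_of_le hab, ofReal_integral_eq_lintegral_ofReal]
  · exact (intervalIntegrable_iff_integrableOn_Ioc_of_le hab).1 integrable
  · exact (ae_restrict_iff' measurableSet_Ioc).2
      (Eventually.of_forall fun x hx => hf_nonneg x (Ioc_subset_Icc_self hx))

lemma lintegral_sq_sub_mul_deriv {t t' : ℝ → ℝ} {a : ℝ} (ha : 0 ≤ a) (ht₀ : t 0 = 0)
    (ht : ∀ x ∈ Icc 0 a, HasDerivAt t (t' x) x) (ht' : ContinuousOn t' (Icc 0 a))
    (ht'_nonneg : ∀ x ∈ Icc 0 a, 0 ≤ t' x) :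
    ∫⁻ b in Ioo 0 a, ENNReal.ofReal ((t a - t b) ^ 2 * (t' a * t' b)) =
      ENNReal.ofReal (t a ^ 3 / 3 * t' a) := by
  rw [restrict_Ioo_eq_restrict_Ioc, lintegral_Ioc_of_hasDerivAt
    (F := fun b => -(t a - t b) ^ 3 / 3 * t' a) ha]
  · congr 1
    simp only [ht₀]
    ring
  · intro b hb
    refine (((((ht b hb).const_sub (t a)).fun_pow 3).neg.div_const 3).mul_const
      (t' a)).congr_deriv ?_
    push_cast
    ring
  · have continuousOn_t : ContinuousOn t (Icc 0 a) := fun x hx =>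
      (ht x hx).continuousAt.continuousWithinAt
    fun_prop
  · exact fun b hb => mul_nonneg (sq_nonneg _)
      (mul_nonneg (ht'_nonneg a (right_mem_Icc.2 ha)) (ht'_nonneg b hb))

lemma lintegral_lintegral_sq_sub_mul_deriv {t t' : ℝ → ℝ} {η : ℝ} (hη : 0 ≤ η) (ht₀ : t 0 = 0)
    (ht : ∀ x ∈ Icc 0 η, HasDerivAt t (t' x) x) (ht' : ContinuousOn t' (Icc 0 η))
    (ht'_nonneg : ∀ x ∈ Icc 0 η, 0 ≤ t' x) :
    ∫⁻ a in Ioc 0 η, ∫⁻ b in Ioo 0 a, ENNReal.ofReal ((t a - t b) ^ 2 * (t' a * t' b)) =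
      ENNReal.ofReal (t η ^ 4 / 12) := by
  have continuousOn_t : ContinuousOn t (Icc 0 η) := fun x hx =>
    (ht x hx).continuousAt.continuousWithinAt
  have t_nonneg : ∀ x ∈ Icc 0 η, 0 ≤ t x := fun x hx => by
    have monotone := monotoneOn_of_deriv_nonneg (convex_Icc 0 η) continuousOn_t
      (fun y hy => (ht y (interior_subset hy)).differentiableAt.differentiableWithinAt)
      (fun y hy => (ht y (interior_subset hy)).deriv ▸ ht'_nonneg y (interior_subset hy))
    exact ht₀ ▸ monotone (left_mem_Icc.2 hη) hx hx.1
  have inner_eq : ∀ a ∈ Ioc 0 η,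
      ∫⁻ b in Ioo 0 a, ENNReal.ofReal ((t a - t b) ^ 2 * (t' a * t' b)) =
        ENNReal.ofReal (t a ^ 3 / 3 * t' a) := fun a ha => by
    have subset : Icc 0 a ⊆ Icc 0 η := Icc_subset_Icc_right ha.2
    exact lintegral_sq_sub_mul_deriv ha.1.le ht₀ (fun x hx => ht x (subset hx)) (ht'.mono subset)
      fun x hx => ht'_nonneg x (subset hx)
  rw [setLIntegral_congr_fun measurableSet_Ioc inner_eq,
    lintegral_Ioc_of_hasDerivAt (F := fun a => t a ^ 4 / 12) hη]
  · congr 1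
    simp only [ht₀]
    ring
  · intro a ha
    refine (((ht a ha).fun_pow 4).div_const 12).congr_deriv ?_
    push_cast
    ring
  · fun_prop
  · exact fun a ha => mul_nonneg (div_nonneg (pow_nonneg (t_nonneg a ha) 3) zero_le_three)
      (ht'_nonneg a ha)

lemma lintegral_cutDomain_gap_pow {η : ℝ} (h₀ : 0 ≤ η) (h₁ : η < 1) :
    ∫⁻ Λ in cutDomain η, ENNReal.ofReal (gap Λ ^ 4)⁻¹ =
      ENNReal.ofReal (Real.pi ^ 4 * ((η / (1 - η)) ^ 4 / 12)) := by
  have one_sub_pos : ∀ x ∈ Icc 0 η, 0 < 1 - x := fun x hx => sub_pos.2 (hx.2.trans_lt h₁)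
  rw [lintegral_cutDomain_comp_gap η (f := fun g => ENNReal.ofReal (g ^ 4)⁻¹) (by fun_prop),
    ENNReal.ofReal_mul (by positivity), ENNReal.ofReal_pow Real.pi_pos.le,
    ← lintegral_lintegral_sq_sub_mul_deriv (t := fun x => x / (1 - x))
      (t' := fun x => ((1 - x) ^ 2)⁻¹) h₀ (by simp only [zero_div])]
  · congr 1
    refine setLIntegral_congr_fun measurableSet_Ioc fun a ha => ?_
    refine setLIntegral_congr_fun measurableSet_Ioo fun b hb => ?_
    have ha' := (one_sub_pos a (Ioc_subset_Icc_self ha)).ne'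
    have hb' := (one_sub_pos b ⟨hb.1.le, hb.2.le.trans ha.2⟩).ne'
    rw [← ENNReal.ofReal_pow (sub_nonneg.2 hb.2.le), ← ENNReal.ofReal_mul (sq_nonneg _)]
    congr 1
    field_simp
    ring
  · intro x hx
    have hx' := (one_sub_pos x hx).ne'
    refine ((hasDerivAt_id x).fun_div ((hasDerivAt_id x).const_sub 1) hx').congr_deriv ?_
    simp only [id]
    field_simp
    ring
  · exact ContinuousOn.inv₀ (by fun_prop) fun x hx => pow_ne_zero 2 (one_sub_pos x hx).ne'
  · exact fun _ _ => by positivity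

lemma invMeasure_coeff_nonneg (n : ℕ) : 0 ≤ ((n : ℝ) - 1) * ((n : ℝ) - 2) ^ 2 * ((n : ℝ) - 3) := by
  rcases lt_or_ge n 3 with hn | hn
  · interval_cases n <;> norm_num
  · have three_le : (3 : ℝ) ≤ n := by exact_mod_cast hn
    exact mul_nonneg (mul_nonneg (by linarith only [three_le]) (sq_nonneg _))
      (by linarith only [three_le])

lemma invMeasure_cutDomain (n : ℕ) {η : ℝ} (h₀ : 0 ≤ η) (h₁ : η < 1) :
    invMeasure n (cutDomain η) = ENNReal.ofReal
      (((n : ℝ) - 1) * ((n : ℝ) - 2) ^ 2 * ((n : ℝ) - 3) * η ^ 4 / (12 * (1 - η) ^ 4)) := by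
  have measurableSet := (isClosed_cutDomain η).measurableSet
  rw [invMeasure, withDensity_apply _ measurableSet, Measure.restrict_restrict measurableSet,
    inter_eq_left.2 (cutDomain_subset_domain h₁)]
  have density_eq : ∀ Λ, ENNReal.ofReal
      (((n : ℝ) - 1) * ((n : ℝ) - 2) ^ 2 * ((n : ℝ) - 3) / (Real.pi ^ 4 * gap Λ ^ 4)) =
        ENNReal.ofReal (((n : ℝ) - 1) * ((n : ℝ) - 2) ^ 2 * ((n : ℝ) - 3) / Real.pi ^ 4) *
          ENNReal.ofReal (gap Λ ^ 4)⁻¹ := fun Λ => by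
    rw [← ENNReal.ofReal_mul (div_nonneg (invMeasure_coeff_nonneg n) (by positivity)),
      ← div_eq_mul_inv, div_div]
  rw [lintegral_congr density_eq, lintegral_const_mul' _ _ ENNReal.ofReal_ne_top,
    lintegral_cutDomain_gap_pow h₀ h₁,
    ← ENNReal.ofReal_mul (div_nonneg (invMeasure_coeff_nonneg n) (by positivity))]
  congr 1
  have one_sub_ne_zero := (sub_pos.2 h₁).ne'
  field_simp

end Volume

section GaussianIntegrals

variable {ι κ : Type*} [Fintype ι] [Fintype κ]

lemma integral_exp_re_mul_sub_norm_sq (c : ℂ) :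
    ∫ z : ℂ, Real.exp (2 * (c * z).re - ‖z‖ ^ 2) = Real.pi * Real.exp (‖c‖ ^ 2) := by
  have gaussian_integral := GaussianFourier.integral_cexp_neg_mul_sq_norm_add (b := 1) (V := ℂ)
    (by simp only [one_re, zero_lt_one]) 2 (conj c)
  have integrand_eq : ∀ z : ℂ, ((Real.exp (2 * (c * z).re - ‖z‖ ^ 2) : ℝ) : ℂ) =
      cexp (-1 * (‖z‖ : ℂ) ^ 2 + 2 * (inner ℝ (conj c) z : ℝ)) := fun z => by
    rw [Complex.inner, Complex.conj_conj]
    push_cast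
    ring_nf
  rw [← ofReal_inj, ← integral_complex_ofReal]
  simp only [integrand_eq]
  rw [gaussian_integral, Complex.finrank_real_complex, RCLike.norm_conj]
  push_cast
  norm_num

lemma integral_exp_re_dotProduct_sub_norm_sq (w : ι → ℂ) :
    ∫ y : ι → ℂ, Real.exp (2 * (w ⬝ᵥ y).re - ∑ i, ‖y i‖ ^ 2) =
      Real.pi ^ Fintype.card ι * Real.exp (∑ i, ‖w i‖ ^ 2) := by
  simp only [dotProduct, Complex.re_sum, Finset.mul_sum, ← Finset.sum_sub_distrib, Real.exp_sum]
  rw [integral_fintype_prod_volume_eq_prod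
    (f := fun i (z : ℂ) => Real.exp (2 * (w i * z).re - ‖z‖ ^ 2))]
  simp only [integral_exp_re_mul_sub_norm_sq, Finset.prod_mul_distrib, Finset.prod_const,
    Finset.card_univ]

lemma integral_exp_neg_posDef [DecidableEq ι] {A : Matrix ι ι ℂ} (hA : A.PosDef) :
    ∫ x : ι → ℂ, Real.exp (-(star x ⬝ᵥ A.mulVec x).re) =
      Real.pi ^ Fintype.card ι / A.det.re := by
  set U : Matrix ι ι ℂ := (hA.isHermitian.eigenvectorUnitary).1
  set eig := hA.isHermitian.eigenvalues
  have rotate : MeasurePreserving (U.mulVec : (ι → ℂ) → ι → ℂ) :=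
    measurePreserving_mulVec
      (CStarRing.norm_of_mem_unitary (Matrix.det_of_mem_unitary (SetLike.coe_mem _)))
  have diagonalize : star U * A * U = Matrix.diagonal (RCLike.ofReal ∘ eig) := by
    have := hA.isHermitian.conjStarAlgAut_star_eigenvectorUnitary
    rwa [Unitary.conjStarAlgAut_star_apply] at this
  have form_eq : ∀ y : ι → ℂ,
      (star (U.mulVec y) ⬝ᵥ A.mulVec (U.mulVec y)).re =
        ∑ i, eig i * ‖y i‖ ^ 2 := fun y => by
    rw [Matrix.star_mulVec, ← Matrix.dotProduct_mulVec, Matrix.mulVec_mulVec, Matrix.mulVec_mulVec,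
      ← Matrix.star_eq_conjTranspose, diagonalize]
    simp only [dotProduct, Matrix.mulVec_diagonal, Function.comp_apply, Pi.star_apply,
      RCLike.star_def, Complex.re_sum]
    refine Finset.sum_congr rfl fun i _ => ?_
    rw [mul_left_comm, Complex.conj_mul']
    exact (re_ofReal_mul (eig i) _).trans (by rw [← ofReal_pow, ofReal_re])
  have integral_coord : ∀ i, ∫ z : ℂ, Real.exp (-(eig i * ‖z‖ ^ 2)) = Real.pi / eig i := fun i => by
    have gaussian_integral :=
      GaussianFourier.integral_rexp_neg_mul_sq_norm (V := ℂ) (hA.eigenvalues_pos i)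
    rw [Complex.finrank_real_complex, Nat.cast_ofNat, div_self two_ne_zero, Real.rpow_one]
      at gaussian_integral
    simpa only [neg_mul] using gaussian_integral
  have det_eq : A.det.re = ∏ i, eig i := by
    rw [hA.isHermitian.det_eq_prod_eigenvalues]
    exact_mod_cast ofReal_re _
  rw [← rotate.map_eq, integral_map rotate.measurable.aemeasurable
    (Continuous.aestronglyMeasurable (by fun_prop))]
  simp only [form_eq, ← Finset.sum_neg_distrib, Real.exp_sum]
  rw [integral_fintype_prod_volume_eq_prod (f := fun i (z : ℂ) => Real.exp (-(eig i * ‖z‖ ^ 2)))]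
  simp only [integral_coord, Finset.prod_div_distrib, Finset.prod_const, Finset.card_univ, det_eq]

lemma integral_exp_norm_sq_vecMul_sub [DecidableEq ι] {Λ : Matrix ι κ ℂ}
    (hΛ : (1 - Λ * Λ.conjTranspose).PosDef) :
    ∫ x : ι → ℂ, Real.exp (∑ j, ‖(Matrix.vecMul x Λ) j‖ ^ 2 - ∑ i, ‖x i‖ ^ 2) =
      Real.pi ^ Fintype.card ι / (1 - Λ * Λ.conjTranspose).det.re := by
  have form_eq : ∀ x : ι → ℂ, ∑ j, ‖(Matrix.vecMul x Λ) j‖ ^ 2 - ∑ i, ‖x i‖ ^ 2 =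
      -(star x ⬝ᵥ (1 - Λ * Λ.conjTranspose).transpose.mulVec x).re := fun x => by
    have form_eq_sub : star x ⬝ᵥ (1 - Λ * Λ.conjTranspose).transpose.mulVec x =
        star x ⬝ᵥ x - star (Matrix.vecMul x Λ) ⬝ᵥ Matrix.vecMul x Λ := by
      rw [Matrix.mulVec_transpose, Matrix.vecMul_sub, Matrix.vecMul_one, dotProduct_sub,
        ← Matrix.vecMul_vecMul, dotProduct_comm (star x) (Matrix.vecMul _ _),
        ← Matrix.dotProduct_mulVec, ← Matrix.star_vecMul, dotProduct_comm (Matrix.vecMul x Λ)]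
    rw [form_eq_sub, ← ofReal_sum_norm_sq, ← ofReal_sum_norm_sq, ← ofReal_sub, ofReal_re, neg_sub]
  simp only [form_eq]
  rw [integral_exp_neg_posDef hΛ.transpose, Matrix.det_transpose]

end GaussianIntegrals

section CoherentNorm

lemma norm_sq_cohFun {n : ℕ} {Λ : Fin 2 → Fin 2 → ℂ} (hΛ : Λ ∈ domain) (p : Modes n) :
    ‖cohFun n Λ p‖ ^ 2 = gap Λ ^ n * Real.exp (2 * (∑ i, ∑ j, Λ i j * Z p i j).re) := by
  have gap_rpow_sq : (gap Λ ^ ((n : ℝ) / 2)) ^ 2 = gap Λ ^ n := by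
    rw [← Real.rpow_mul_natCast (gap_pos hΛ).le, Nat.cast_ofNat, div_mul_cancel₀ _ two_ne_zero,
      Real.rpow_natCast]
  rw [cohFun, norm_mul, mul_pow, Complex.norm_real, Real.norm_eq_abs, sq_abs, gap_rpow_sq,
    Complex.norm_exp, ← Real.exp_nat_mul, Nat.cast_ofNat]

lemma density_mul_norm_sq_cohFun {n : ℕ} {Λ : Fin 2 → Fin 2 → ℂ} (hΛ : Λ ∈ domain)
    (p : Modes n) :
    (Real.pi ^ (4 * n))⁻¹ * Real.exp (-sqNorm p) * ‖cohFun n Λ p‖ ^ 2 =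
      (Real.pi ^ (4 * n))⁻¹ * gap Λ ^ n *
        Real.exp (2 * (∑ i, ∑ j, Λ i j * Z p i j).re - sqNorm p) := by
  rw [norm_sq_cohFun hΛ, sub_eq_add_neg, Real.exp_add]
  ring

lemma integrable_exp_sum_mul_Z (n : ℕ) {Λ : Fin 2 → Fin 2 → ℂ} (hΛ : Λ ∈ domain) :
    Integrable fun p : Modes n =>
      Real.exp (2 * (∑ i, ∑ j, Λ i j * Z p i j).re - sqNorm p) := by
  have memLp := memLp_cohFun n hΛ
  have := continuous_sqNorm n
  rw [memLp_two_iff_integrable_sq_norm (differentiable_cohFun n Λ).continuous.aestronglyMeasurable,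
    gaussian, integrable_withDensity_iff_integrable_smul₀' (by fun_prop) (by simp)] at memLp
  simp only [ENNReal.toReal_ofReal (density_pos _).le, smul_eq_mul,
    density_mul_norm_sq_cohFun hΛ] at memLp
  rwa [integrable_const_mul_iff (by simp [(gap_pos hΛ).ne', Real.pi_ne_zero])] at memLp

lemma sum_mul_Z_eq {n : ℕ} (Λ : Fin 2 → Fin 2 → ℂ) (p : Modes n) :
    ∑ i, ∑ j, Λ i j * Z p i j = ∑ k, Matrix.vecMul (p.1 k) (Matrix.of Λ) ⬝ᵥ p.2 k := by
  simp only [Z, Matrix.vecMul, dotProduct, Fin.sum_univ_two, Finset.mul_sum,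
    ← Finset.sum_add_distrib, Matrix.of_apply]
  refine Finset.sum_congr rfl fun k _ => ?_
  ring

lemma integral_exp_sum_mul_Z_snd {n : ℕ} (Λ : Fin 2 → Fin 2 → ℂ) (z : Fin n → Fin 2 → ℂ) :
    ∫ z' : Fin n → Fin 2 → ℂ,
        Real.exp (2 * (∑ i, ∑ j, Λ i j * Z (z, z') i j).re - sqNorm (z, z')) =
      ∏ k, (Real.pi ^ 2 *
        Real.exp (∑ j, ‖Matrix.vecMul (z k) (Matrix.of Λ) j‖ ^ 2 - ∑ i, ‖z k i‖ ^ 2)) := by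
  have integrand_eq : ∀ z' : Fin n → Fin 2 → ℂ,
      Real.exp (2 * (∑ i, ∑ j, Λ i j * Z (z, z') i j).re - sqNorm (z, z')) =
        ∏ k, Real.exp (-∑ i, ‖z k i‖ ^ 2) *
          Real.exp (2 * (Matrix.vecMul (z k) (Matrix.of Λ) ⬝ᵥ z' k).re - ∑ j, ‖z' k j‖ ^ 2) :=
    fun z' => by
      simp only [← Real.exp_add, ← Real.exp_sum, sum_mul_Z_eq, sqNorm, Complex.re_sum,
        Finset.mul_sum, Finset.sum_add_distrib, Finset.sum_sub_distrib, Finset.sum_neg_distrib]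
      ring_nf
  simp only [integrand_eq]
  rw [integral_fintype_prod_volume_eq_prod (f := fun k (y : Fin 2 → ℂ) =>
    Real.exp (-∑ i, ‖z k i‖ ^ 2) *
      Real.exp (2 * (Matrix.vecMul (z k) (Matrix.of Λ) ⬝ᵥ y).re - ∑ j, ‖y j‖ ^ 2))]
  refine Finset.prod_congr rfl fun k _ => ?_
  rw [integral_const_mul, integral_exp_re_dotProduct_sub_norm_sq, Fintype.card_fin, sub_eq_add_neg,
    Real.exp_add]
  ring

lemma integral_exp_sum_mul_Z (n : ℕ) {Λ : Fin 2 → Fin 2 → ℂ} (hΛ : Λ ∈ domain) :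
    ∫ p : Modes n, Real.exp (2 * (∑ i, ∑ j, Λ i j * Z p i j).re - sqNorm p) =
      (Real.pi ^ 4 / gap Λ) ^ n := by
  rw [Measure.volume_eq_prod, integral_prod _ (integrable_exp_sum_mul_Z n hΛ)]
  simp only [integral_exp_sum_mul_Z_snd]
  rw [integral_fintype_prod_volume_eq_pow (fun x : Fin 2 → ℂ => Real.pi ^ 2 *
    Real.exp (∑ j, ‖Matrix.vecMul x (Matrix.of Λ) j‖ ^ 2 - ∑ i, ‖x i‖ ^ 2)),
    integral_const_mul, integral_exp_norm_sq_vecMul_sub hΛ, Fintype.card_fin, Fintype.card_fin, gap]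
  ring

lemma integral_norm_sq_cohFun (n : ℕ) {Λ : Fin 2 → Fin 2 → ℂ} (hΛ : Λ ∈ domain) :
    ∫ p, ‖cohFun n Λ p‖ ^ 2 ∂(gaussian n) = 1 := by
  have gap_pos := gap_pos hΛ
  have := continuous_sqNorm n
  rw [gaussian, integral_withDensity_eq_integral_toReal_smul (by fun_prop) (by simp)]
  simp only [ENNReal.toReal_ofReal (density_pos _).le, smul_eq_mul,
    density_mul_norm_sq_cohFun hΛ]
  rw [integral_const_mul, integral_exp_sum_mul_Z n hΛ, div_pow, ← pow_mul]
  field_simp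

/-- The inclusion of the Fock space into `L²` of the Gaussian measure, as an isometry. -/
def toL2 (n : ℕ) : Fock n →ₗᵢ[ℂ] Lp ℂ 2 (gaussian n) := (fockSubmodule n).subtypeₗᵢ

lemma toL2_coherent (n : ℕ) {Λ : Fin 2 → Fin 2 → ℂ} (hΛ : Λ ∈ domain) :
    toL2 n (coherent n Λ) = (memLp_cohFun n hΛ).toLp :=
  congrArg (toL2 n) (dif_pos hΛ)

lemma norm_coherent (n : ℕ) {Λ : Fin 2 → Fin 2 → ℂ} (hΛ : Λ ∈ domain) : ‖coherent n Λ‖ = 1 := by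
  rw [← (toL2 n).norm_map, toL2_coherent n hΛ, Lp.norm_toLp,
    (memLp_cohFun n hΛ).eLpNorm_eq_integral_rpow_norm two_ne_zero ENNReal.ofNat_ne_top]
  simp only [ENNReal.toReal_ofNat, Real.rpow_ofNat, integral_norm_sq_cohFun n hΛ, Real.one_rpow,
    ENNReal.ofReal_one, ENNReal.toReal_one]

end CoherentNorm

section Convergence

variable {α E : Type*} {mα : MeasurableSpace α} {μ : Measure α} [NormedAddCommGroup E]

-- Fatou's lemma bounds `‖v + v‖` by the lower limit of `‖u k + v‖`, and the parallelogram law turns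
-- convergence of `‖u k + v‖` to `2 ‖v‖` into convergence of `u k - v` to `0`.
lemma tendsto_Lp_two_of_ae_of_norm [InnerProductSpace ℂ E] {u : ℕ → Lp E 2 μ} {v : Lp E 2 μ}
    (ae_tendsto : ∀ᵐ a ∂μ, Tendsto (fun k => u k a) atTop (𝓝 (v a)))
    (norm_tendsto : Tendsto (fun k => ‖u k‖) atTop (𝓝 ‖v‖)) : Tendsto u atTop (𝓝 v) := by
  have fatou : ‖v + v‖ₑ ≤ liminf (fun k => ‖u k + v‖ₑ) atTop := by
    simp only [Lp.enorm_def]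
    refine Lp.eLpNorm_lim_le_liminf_eLpNorm (fun k => Lp.aestronglyMeasurable _) _ ?_
    filter_upwards [ae_tendsto, Lp.coeFn_add v v, ae_all_iff.2 fun k => Lp.coeFn_add (u k) v]
      with a ha add_self add
    simpa only [add_self, add, Pi.add_apply] using ha.add_const (v a)
  have norm_add_self : ‖v + v‖ = ‖v‖ + ‖v‖ := by
    rw [← two_smul ℝ v, norm_smul, Real.norm_two, two_mul]
  have enorm_tendsto : Tendsto (fun k => ‖u k + v‖ₑ) atTop (𝓝 ‖v + v‖ₑ) := by
    have upper : Tendsto (fun k => ENNReal.ofReal (‖u k‖ + ‖v‖)) atTop (𝓝 ‖v + v‖ₑ) := by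
      rw [← ofReal_norm, norm_add_self]
      exact ENNReal.tendsto_ofReal (norm_tendsto.add_const _)
    refine tendsto_of_le_liminf_of_limsup_le fatou (upper.limsup_eq ▸ limsup_le_limsup ?_)
    exact Eventually.of_forall fun k =>
      (ofReal_norm _).symm.trans_le (ENNReal.ofReal_le_ofReal (norm_add_le _ _))
  have add_tendsto : Tendsto (fun k => ‖u k + v‖) atTop (𝓝 (‖v‖ + ‖v‖)) := by
    simpa only [Function.comp_def, toReal_enorm, norm_add_self] using
      (ENNReal.tendsto_toReal enorm_ne_top).comp enorm_tendsto
  have parallelogram : ∀ k, ‖u k - v‖ ^ 2 = 2 * (‖u k‖ ^ 2 + ‖v‖ ^ 2) - ‖u k + v‖ ^ 2 := fun k => by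
    linarith [parallelogram_law_with_norm ℂ (u k) v]
  have sq_tendsto : Tendsto (fun k => ‖u k - v‖ ^ 2) atTop (𝓝 0) := by
    simp only [parallelogram]
    convert (((norm_tendsto.pow 2).add_const (‖v‖ ^ 2)).const_mul 2).sub (add_tendsto.pow 2) using 2
    ring
  refine tendsto_iff_norm_sub_tendsto_zero.2 ?_
  simpa only [Real.sqrt_sq (norm_nonneg _), Real.sqrt_zero] using sq_tendsto.sqrt

end Convergence

section CoherentContinuity

lemma continuous_cohFun (n : ℕ) (p : Modes n) : Continuous fun Λ => cohFun n Λ p := by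
  have := continuous_gap.rpow_const (p := (n : ℝ) / 2) fun _ => Or.inr (by positivity)
  unfold cohFun
  fun_prop

lemma continuousOn_coherent (n : ℕ) : ContinuousOn (coherent n) domain := by
  rw [continuousOn_iff_continuous_domRestrict, continuous_iff_seqContinuous]
  intro Λ Λ₀ hΛ
  refine (toL2 n).isometry.isEmbedding.tendsto_nhds_iff.2 (tendsto_Lp_two_of_ae_of_norm ?_ ?_)
  · have ae_eq : ∀ M : domain, toL2 n (coherent n M) =ᵐ[gaussian n] cohFun n M := fun M =>
      toL2_coherent n M.2 ▸ (memLp_cohFun n M.2).coeFn_toLp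
    filter_upwards [ae_eq Λ₀, ae_all_iff.2 fun k => ae_eq (Λ k)] with p eq_limit eq_seq
    simp only [Function.comp_apply, Set.domRestrict_apply, eq_limit, eq_seq]
    exact ((continuous_cohFun n p).comp continuous_subtype_val).seqContinuous hΛ
  · simp only [Function.comp_apply, Set.domRestrict_apply, (toL2 n).norm_map,
      norm_coherent n (Subtype.prop _)]
    exact tendsto_const_nhds

instance secondCountableTopology_fock (n : ℕ) : SecondCountableTopology (Fock n) :=
  have : Fact ((2 : ℝ≥0∞) ≠ ∞) := ⟨ENNReal.ofNat_ne_top⟩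
  have : MeasurableSpace.CountablyGenerated (Modes n) := inferInstance
  have : MeasureTheory.IsSeparable (gaussian n) := inferInstance
  (toL2 n).isometry.isEmbedding.secondCountableTopology

end CoherentContinuity

section CutOperator

variable {n : ℕ} {η : ℝ}

lemma measure_cutDomain_lt_top (h₀ : 0 ≤ η) (h₁ : η < 1) : invMeasure n (cutDomain η) < ∞ :=
  (invMeasure_cutDomain n h₀ h₁).trans_lt ENNReal.ofReal_lt_top

lemma ae_norm_coherent (h₁ : η < 1) :
    ∀ᵐ Λ ∂(invMeasure n).restrict (cutDomain η), ‖coherent n Λ‖ = 1 :=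
  ae_restrict_of_forall_mem (isClosed_cutDomain η).measurableSet fun _ hΛ =>
    norm_coherent n (cutDomain_subset_domain h₁ hΛ)

lemma memLp_coherent (h₀ : 0 ≤ η) (h₁ : η < 1) :
    MemLp (coherent n) 2 ((invMeasure n).restrict (cutDomain η)) := by
  have : IsFiniteMeasure ((invMeasure n).restrict (cutDomain η)) :=
    isFiniteMeasure_restrict.2 (measure_cutDomain_lt_top h₀ h₁).ne
  exact .of_bound (((continuousOn_coherent n).mono
    (cutDomain_subset_domain h₁)).aestronglyMeasurable (isClosed_cutDomain η).measurableSet) 1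
    ((ae_norm_coherent h₁).mono fun _ h => h.le)

lemma integrableOn_projector (h₀ : 0 ≤ η) (h₁ : η < 1) :
    IntegrableOn (projector n) (cutDomain η) (invMeasure n) :=
  integrable_rankOne_self (memLp_coherent h₀ h₁)

lemma isTraceClass_cutOperator (h₀ : 0 ≤ η) (h₁ : η < 1) : IsTraceClass (cutOperator n η) :=
  isTraceClass_integral_rankOne_self (memLp_coherent h₀ h₁)

lemma hasTrace_cutOperator (h₀ : 0 ≤ η) (h₁ : η < 1) :
    HasTrace (cutOperator n η)
      ((((n : ℝ) - 1) * ((n : ℝ) - 2) ^ 2 * ((n : ℝ) - 3) * η ^ 4 /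
        (12 * (1 - η) ^ 4) : ℝ) : ℂ) := by
  have trace_eq : ∫ Λ in cutDomain η, ‖coherent n Λ‖ ^ 2 ∂(invMeasure n) =
      ((n : ℝ) - 1) * ((n : ℝ) - 2) ^ 2 * ((n : ℝ) - 3) * η ^ 4 / (12 * (1 - η) ^ 4) := by
    rw [integral_congr_ae ((ae_norm_coherent h₁).mono fun Λ h => by rw [h, one_pow]),
      integral_const, smul_eq_mul, mul_one, measureReal_restrict_apply_univ, measureReal_def,
      invMeasure_cutDomain n h₀ h₁, ENNReal.toReal_ofReal]
    have := invMeasure_coeff_nonneg n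
    have := sub_pos.2 h₁
    positivity
  exact trace_eq ▸ hasTrace_integral_rankOne_self (memLp_coherent h₀ h₁)

end CutOperator

section Bounds

variable {m K : ℝ}

lemma quartic_le (hm : 17 ≤ m) : (m + 4) * (m + 3) ^ 2 * (m + 2) ≤ 192 / 100 * m ^ 4 := by
  calc (m + 4) * (m + 3) ^ 2 * (m + 2) ≤ 21 / 17 * m * (20 / 17 * m) ^ 2 * (19 / 17 * m) := by
        gcongr <;> linarith
    _ = 159600 / 83521 * m ^ 4 := by ring
    _ ≤ 192 / 100 * m ^ 4 := mul_le_mul_of_nonneg_right (by norm_num) (by positivity)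

lemma pow_four_add_sub_pow_four_le (hm : 0 ≤ m) (hK : m ≤ K) : m ^ 4 + (K - m) ^ 4 ≤ K ^ 4 := by
  simpa using pow_add_pow_le hm (sub_nonneg.2 hK) four_ne_zero

lemma trace_add_one_le (hm : 17 ≤ m) (hK : m ≤ K) :
    (m + 4) * (m + 3) ^ 2 * (m + 2) * ((K - m) / (K + m)) ^ 4 /
      (12 * (1 - (K - m) / (K + m)) ^ 4) + 1 ≤ K ^ 4 / 100 := by
  have m_pos : 0 < m := by linarith
  have sum_pos : 0 < K + m := by linarith
  have one_sub_eq : 1 - (K - m) / (K + m) = 2 * m / (K + m) := by field_simp; ring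
  calc (m + 4) * (m + 3) ^ 2 * (m + 2) * ((K - m) / (K + m)) ^ 4 /
        (12 * (1 - (K - m) / (K + m)) ^ 4) + 1
      = (m + 4) * (m + 3) ^ 2 * (m + 2) / (192 * m ^ 4) * (K - m) ^ 4 + 1 := by
        rw [one_sub_eq]; field_simp; ring
    _ ≤ 1 / 100 * (K - m) ^ 4 + m ^ 4 / 100 := by
        have ratio_le : (m + 4) * (m + 3) ^ 2 * (m + 2) / (192 * m ^ 4) ≤ 1 / 100 := by
          rw [div_le_iff₀ (by positivity)]
          linarith [quartic_le hm]
        have one_le : 1 ≤ m ^ 4 / 100 := by linarith [pow_le_pow_left₀ (by norm_num) hm 4]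
        exact add_le_add (mul_le_mul_of_nonneg_right ratio_le (by positivity)) one_le
    _ ≤ K ^ 4 / 100 := by linarith [pow_four_add_sub_pow_four_le m_pos.le hK]

end Bounds

end SU22
end

theorem mainTheorem6_general (n : ℕ) (hn : 22 ≤ n) (K η : ℝ) (hK : (n : ℝ) - 5 ≤ K)
    (hη : η = (K - (n : ℝ) + 5) / (K + (n : ℝ) - 5)) :
    IntegrableOn (SU22.projector n) (SU22.cutDomain η) (SU22.invMeasure n) ∧
    SU22.IsTraceClass (SU22.cutOperator n η) ∧
    ∃ T : ℝ, SU22.HasTrace (SU22.cutOperator n η) (T : ℂ) ∧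
      T = ((n : ℝ) - 1) * ((n : ℝ) - 2) ^ 2 * ((n : ℝ) - 3) * η ^ 4 / (12 * (1 - η) ^ 4) ∧
      T ≤ K ^ 4 / 100 ∧
      T + 1 ≤ K ^ 4 / 100 := by
  have n_ge : (22 : ℝ) ≤ n := mod_cast hn
  have denominator_pos : 0 < K + (n : ℝ) - 5 := by linarith
  have η_nonneg : 0 ≤ η := hη ▸ div_nonneg (by linarith) denominator_pos.le
  have η_lt_one : η < 1 := by rw [hη, div_lt_one denominator_pos]; linarith
  have bound : ((n : ℝ) - 1) * ((n : ℝ) - 2) ^ 2 * ((n : ℝ) - 3) * η ^ 4 / (12 * (1 - η) ^ 4) + 1 ≤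
      K ^ 4 / 100 := by
    convert SU22.trace_add_one_le (m := (n : ℝ) - 5) (by linarith) hK using 2
    rw [hη]
    ring_nf
  exact ⟨SU22.integrableOn_projector η_nonneg η_lt_one,
    SU22.isTraceClass_cutOperator η_nonneg η_lt_one, _,
    SU22.hasTrace_cutOperator η_nonneg η_lt_one, rfl, by linarith, bound⟩

theorem mainTheorem6 (n : ℕ) (hn : 38 ≤ n) (K η : ℝ) (hK : (n : ℝ) - 5 ≤ K)
    (hη : η = (K - (n : ℝ) + 5) / (K + (n : ℝ) - 5)) :
    IntegrableOn (SU22.projector n) (SU22.cutDomain η) (SU22.invMeasure n) ∧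
    SU22.IsTraceClass (SU22.cutOperator n η) ∧
    ∃ T : ℝ, SU22.HasTrace (SU22.cutOperator n η) (T : ℂ) ∧
      T = ((n : ℝ) - 1) * ((n : ℝ) - 2) ^ 2 * ((n : ℝ) - 3) * η ^ 4 / (12 * (1 - η) ^ 4) ∧
      T ≤ K ^ 4 / 100 ∧
      T + 1 ≤ K ^ 4 / 100 :=
  mainTheorem6_general n (by lia) K η hK hη
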